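/- **Notation.** Let $n\ge 1$ and $[m]=\{1,\dots,m\}$. Permutations $\sigma\in\mathfrak S_n$ are written as words $\sigma(1)\cdots\sigma(n)$ and multiplied as maps; $s_i=(i,i+1)$, and $\ell$ is the length with respect to $s_1,\dots,s_{n-1}$. Put $\mathrm{Des}_L(\sigma)=\{i:\ell(s_i\sigma)<\ell(\sigma)\}$ and $\mathrm{Des}_R(\sigma)=\{i:\ell(\sigma s_i)<\ell(\sigma)\}$. The left (right) weak order $\preceq_L$ ($\preceq_R$) is the partial order with covering relations $\sigma\prec s_i\sigma$ for $i\notin\mathrm{Des}_L(\sigma)$ (respectively $\sigma\prec\sigma s_i$ for $i\notin\mathrm{Des}_R(\sigma)$). If $\sigma\preceq_L\rho$, put $[\sigma,\rho]_L=\{\gamma:\sigma\preceq_L\gamma\preceq_L\rho\}$; these sets are the weak Bruhat intervals. For $S\subseteq[n-1]$ put $S^c=[n-1]\setminus S$; $w_0(S)$ is the longest element of the subgroup generated by $\{s_i:i\in S\}$, and $w_1(S)$ is the longest element of $\{z:\mathrm{Des}_R(z)\subseteq S\}$. Intervals $[w_0(S),\rho]_L$ are called lower descent intervals and intervals $[\sigma,w_1(S)]_L$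 upper descent intervals. Two weak Bruhat intervals are equivalent if there is an isomorphism of posets between them (for $\preceq_L$) that preserves $\mathrm{Des}_L$. An equivalence class $C$ is ordered by $[\sigma,\rho]_L\preceq[\sigma',\rho']_L\iff\sigma\preceq_R\sigma'$. Let $C_{S;\rho}$ and $C_{\sigma;S}$ be the classes of $[w_0(S),\rho]_L$ and $[\sigma,w_1(S)]_L$. A *diagram* is a set $D$ of $n$ boxes $(x,y)$ (column $x$ from the left, row $y$ from the bottom) whose columns and rows that contain a box are exactly the columns $1,\dots,c$ and the rows $1,\dots,r$, for some $c,r$. It has a *strictly upper-right pair* if there are boxes $(x_1,y_1),(x_2,y_2)\in D$ with $x_1<x_2$, $y_1<y_2$ and no other box $(x,y)\in D$ with $x_1\le x\le x_2$, $y_1\le y\le y_2$. Let $\mathsf r(D)$ be the sequence of the numbers of boxes in the rows from top to bottom, $\mathsf c(D)$ that of the numbers of boxes in the columns from left to right, and $\mathrm{set}(\alpha)=\{\alpha_1,\alpha_1+\alpha_2,\dots,\alpha_1+\dots+\alpha_{l-1}\}$ for $\alpha=(\alpha_1,\dots,\alpha_l)$. A standard filling of $D$ is a bijection $F:D\to[n]$,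 and $P_F$ is the poset on $[n]$ in which $i\le j$ iff the box of $i$ is weakly left of and weakly below the box of $j$. For a poset $P$ on $[n]$, $\Sigma_L(P)=\{\sigma\in\mathfrak S_n:\sigma(i)\le\sigma(j)\text{ whenever }i\le_P j\}$. Let $\mathrm{ST}(D)$ be the set of standard fillings $T$ with $T(i,j)\le T(k,l)$ whenever $i\le k$, $j\le l$. Write $\mathrm{read}^{\downarrow}(F)$ for the word of the entries of $F$ read down each column, columns from left to right, and $\mathrm{read}^{\rightarrow}(F)$ for the word read from left to right along each row, rows from top to bottom. The filling $F_D^{\downarrow}$ (respectively $F_D^{\rightarrow}$) is the one with $\mathrm{read}^{\downarrow}=12\cdots n$ (respectively $\mathrm{read}^{\rightarrow}=12\cdots n$). The tableau $T'_D$ is filled with $1,\dots,n$ along the columns from left to right, each from bottom to top, and $T_D$ along the rows from bottom to top, each from left to right. Let $D^x=\{(x,r+1-y):(x,y)\in D\}$, where $r$ is the number of rows of $D$, and for a filling $T$ of $D^x$ let $T^x$ be the filling of $D$ with $T^x(x,y)=T(x,r+1-y)$. Order $\mathrm{ST}(D)$ by $T\trianglelefteq U\iff\mathrm{read}^{\downarrow}(T)\preceq_L\mathrm{read}^{\downarrow}(U)$.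 For $A\subseteq[n-1]$, cut $[n]$ after each element of $A$ into consecutive blocks $B_1(A),\dots,B_{|A|+1}(A)$. Define $$D_{S;\rho}=\{(i,j):\exists k,\ k\in B_i(S^c),\ \rho(k)\in B_j(\mathrm{Des}_L(\rho))\},$$ $$D_{\sigma;S}=\{(i,j):\exists k,\ k\in B_{|S|+2-j}(S),\ \sigma(k)\in B_i(\mathrm{Des}_L(\sigma)^c)\}.$$ **Theorem.** Let $S\subseteq[n-1]$. (a) Let $w_0(S)\preceq_L\rho$ and suppose that $D:=D_{S;\rho}$ has no strictly upper-right pair. Then $D$ is a diagram with $n$ boxes and $$\max C_{S;\rho}=\Sigma_L(P_{F_D^{\rightarrow}})=[\mathrm{read}^{\rightarrow}(T'_D),\,w_1(\mathrm{set}(\mathsf r(D)))]_L .$$ Moreover $C_{S;\rho}=\{\Sigma_L(P_{T^x}):T\in\mathrm{ST}(D^x)\}$, and $(C_{S;\rho},\preceq)\cong(\mathrm{ST}(D^x),\trianglelefteq)$ as posets. (b) Let $\sigma\preceq_L w_1(S)$ and suppose that $E:=D_{\sigma;S}$ has no strictly upper-right pair. Then $E$ is a diagram with $n$ boxes and $$\min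 C_{\sigma;S}=\Sigma_L(P_{F_E^{\downarrow}})=[w_0(\mathrm{set}(\mathsf c(E))^c),\,\mathrm{read}^{\downarrow}(T_E)]_L .$$ Moreover $C_{\sigma;S}=\{\Sigma_L(P_{T^x}):T\in\mathrm{ST}(E^x)\}$, and $(C_{\sigma;S},\preceq)\cong(\mathrm{ST}(E^x),\trianglelefteq)$ as posets. -/

import Mathlib

/-!  The letters `1, …, n` are the elements `0, …, n - 1` of `Fin n`, and the indices `1, …, n - 1`
of the simple transpositions are the elements `0, …, n - 2` of `Fin (n - 1)`: the element `i` of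
either type stands for the positive integer `i + 1`. A permutation `σ` has the one-line notation
`σ(1) σ(2) ⋯ σ(n)`, and `(σ * τ) k = σ (τ k)`. -/

namespace WeakBruhat

/-! ### The symmetric group and the weak Bruhat orders -/

/-- The transposition exchanging the `i`th and the `(i+1)`st letter. -/
def simpleTransp {n : ℕ} (i : Fin (n - 1)) : Equiv.Perm (Fin n) :=
  Equiv.swap ⟨i.val, by omega⟩ ⟨i.val + 1, by omega⟩

/-- The minimal number of factors in an expression of `σ` as a product of simple transpositions. -/
noncomputable def length {n : ℕ} (σ : Equiv.Perm (Fin n)) : ℕ :=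
  sInf {k | ∃ l : List (Fin (n - 1)), l.length = k ∧ (l.map simpleTransp).prod = σ}

/-- The left descent set. -/
noncomputable def leftDescents {n : ℕ} (σ : Equiv.Perm (Fin n)) : Finset (Fin (n - 1)) :=
  Finset.univ.filter fun i => length (simpleTransp i * σ) < length σ

/-- The right descent set. -/
noncomputable def rightDescents {n : ℕ} (σ : Equiv.Perm (Fin n)) : Finset (Fin (n - 1)) :=
  Finset.univ.filter fun i => length (σ * simpleTransp i) < length σ

/-- The left weak Bruhat order: the reflexive transitive closure of its covering relation. -/
def LeftLE {n : ℕ} : Equiv.Perm (Fin n) → Equiv.Perm (Fin n) → Prop :=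
  Relation.ReflTransGen fun σ τ => ∃ i, i ∉ leftDescents σ ∧ τ = simpleTransp i * σ

/-- The right weak Bruhat order. -/
def RightLE {n : ℕ} : Equiv.Perm (Fin n) → Equiv.Perm (Fin n) → Prop :=
  Relation.ReflTransGen fun σ τ => ∃ i, i ∉ rightDescents σ ∧ τ = σ * simpleTransp i

/-- The set `[σ, ρ]_L`. -/
def leftInterval {n : ℕ} (σ ρ : Equiv.Perm (Fin n)) : Set (Equiv.Perm (Fin n)) :=
  {γ | LeftLE σ γ ∧ LeftLE γ ρ}

/-- A longest element of a nonempty set of permutations. -/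
noncomputable def longest {n : ℕ} (A : Set (Equiv.Perm (Fin n))) (hA : A.Nonempty) :
    Equiv.Perm (Fin n) :=
  (Set.exists_max_image A length A.toFinite hA).choose

/-- The parabolic subgroup generated by the simple transpositions with index in `S`. -/
def parabolic {n : ℕ} (S : Finset (Fin (n - 1))) : Subgroup (Equiv.Perm (Fin n)) :=
  Subgroup.closure (simpleTransp '' (S : Set (Fin (n - 1))))

/-- The set of minimal length representatives of the left cosets of `parabolic S`. -/
def minCosetReps {n : ℕ} (S : Finset (Fin (n - 1))) : Set (Equiv.Perm (Fin n)) :=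
  {z | rightDescents z ⊆ Sᶜ}

theorem length_one {n : ℕ} : length (1 : Equiv.Perm (Fin n)) = 0 :=
  Nat.sInf_eq_zero.mpr (Or.inl ⟨[], rfl, rfl⟩)

theorem minCosetReps_nonempty {n : ℕ} (S : Finset (Fin (n - 1))) : (minCosetReps S).Nonempty :=
  ⟨1, fun i hi => by simp [rightDescents, length_one] at hi⟩

/-- The longest element `w_0(S)` of the parabolic subgroup of `S`. -/
noncomputable def w0 {n : ℕ} (S : Finset (Fin (n - 1))) : Equiv.Perm (Fin n) :=
  longest (parabolic S : Set (Equiv.Perm (Fin n))) ⟨1, (parabolic S).one_mem⟩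

/-- The longest minimal length representative `w_1(S)` of the left cosets of the parabolic
subgroup of the complement of `S`. -/
noncomputable def w1 {n : ℕ} (S : Finset (Fin (n - 1))) : Equiv.Perm (Fin n) :=
  longest (minCosetReps Sᶜ) (minCosetReps_nonempty _)

/-! ### Classes of weak Bruhat intervals -/

/-- The set of nonempty left weak Bruhat intervals. -/
def leftIntervals (n : ℕ) : Set (Set (Equiv.Perm (Fin n))) :=
  {I | ∃ σ ρ, LeftLE σ ρ ∧ I = leftInterval σ ρ}

/-- There is a descent-preserving poset isomorphism from `I` to `J`, both with the left order. -/
def DescentIso {n : ℕ} (I J : Set (Equiv.Perm (Fin n))) : Prop :=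
  ∃ f : I ≃ J, (∀ γ δ : I, LeftLE (f γ : Equiv.Perm (Fin n)) (f δ) ↔
      LeftLE (γ : Equiv.Perm (Fin n)) δ) ∧
    ∀ γ : I, leftDescents (f γ : Equiv.Perm (Fin n)) = leftDescents (γ : Equiv.Perm (Fin n))

/-- The equivalence class of the interval `I` in the set of left weak Bruhat intervals. -/
def descentClass {n : ℕ} (I : Set (Equiv.Perm (Fin n))) : Set (Set (Equiv.Perm (Fin n))) :=
  {J | J ∈ leftIntervals n ∧ DescentIso I J}

/-- The relation `[σ, ρ]_L ⪯ [σ', ρ']_L` if and only if `σ ≤ σ'` in the right weak order. -/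
def IntervalLE {n : ℕ} (I J : Set (Equiv.Perm (Fin n))) : Prop :=
  ∃ σ ρ σ' ρ', LeftLE σ ρ ∧ I = leftInterval σ ρ ∧ LeftLE σ' ρ' ∧ J = leftInterval σ' ρ' ∧
    RightLE σ σ'

/-- `M` is the maximum of `C`. -/
def IsMaxOf {n : ℕ} (C : Set (Set (Equiv.Perm (Fin n)))) (M : Set (Equiv.Perm (Fin n))) : Prop :=
  M ∈ C ∧ ∀ J ∈ C, IntervalLE J M

/-- `M` is the minimum of `C`. -/
def IsMinOf {n : ℕ} (C : Set (Set (Equiv.Perm (Fin n)))) (M : Set (Equiv.Perm (Fin n))) : Prop :=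
  M ∈ C ∧ ∀ J ∈ C, IntervalLE M J

/-! ### Diagrams -/

/-- The number of nonempty rows; the box `(x, y)` lies in column `x` (from the left) and row `y`
(from the bottom), counted from one. -/
def numRows (D : Finset (ℕ × ℕ)) : ℕ := (D.image Prod.snd).card

/-- The number of nonempty columns. -/
def numCols (D : Finset (ℕ × ℕ)) : ℕ := (D.image Prod.fst).card

/-- `D` consists of `n` boxes, and it has no empty row or column in its smallest enclosing
rectangle, the lower left corner of which is at `(1, 1)`. -/
structure IsDiagram (n : ℕ) (D : Finset (ℕ × ℕ)) : Prop where
  card_eq : D.card = n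
  cols_eq : D.image Prod.fst = Finset.Icc 1 (numCols D)
  rows_eq : D.image Prod.snd = Finset.Icc 1 (numRows D)

/-- No two boxes of `D`, one strictly to the right of and strictly above the other, span a
rectangle that holds no further box of `D`. -/
def FreeOfStrictlyUpperRight (D : Finset (ℕ × ℕ)) : Prop :=
  ¬ ∃ b ∈ D, ∃ c ∈ D, b.1 < c.1 ∧ b.2 < c.2 ∧ ∀ d ∈ D, b ≤ d → d ≤ c → d = b ∨ d = c

/-- The numbers of boxes in the rows, from the top row to the bottom row. -/
def rowLengths (D : Finset (ℕ × ℕ)) : List ℕ :=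
  (List.range (numRows D)).map fun k => (D.filter fun b => b.2 = numRows D - k).card

/-- The numbers of boxes in the columns, from left to right. -/
def colLengths (D : Finset (ℕ × ℕ)) : List ℕ :=
  (List.range (numCols D)).map fun k => (D.filter fun b => b.1 = k + 1).card

/-- The set `{α_1, α_1 + α_2, …, α_1 + ⋯ + α_{l-1}}` of a composition `α` with `l` parts. -/
def compSet (n : ℕ) (α : List ℕ) : Finset (Fin (n - 1)) :=
  Finset.univ.filter fun i => i.val + 1 ∈ (Finset.Ico 1 α.length).image fun k => (α.take k).sum

/-- Cut `1, …, n` after each element of `A` into consecutive blocks, numbered from one: the number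
of the block that contains `k`. -/
def blockIndex {n : ℕ} (A : Finset (Fin (n - 1))) (k : Fin n) : ℕ :=
  1 + (A.filter fun z => z.val < k.val).card

/-- The diagram `D_{S;ρ}`: its boxes are the `(i, j)` for which some position `k` lies in the `i`th
block of positions, cut after the elements of the complement of `S`, while the value `ρ k` lies in
the `j`th block of values, cut after the left descents of `ρ`. -/
noncomputable def lowerDiagram {n : ℕ} (S : Finset (Fin (n - 1))) (ρ : Equiv.Perm (Fin n)) :
    Finset (ℕ × ℕ) :=
  Finset.univ.image fun k : Fin n => (blockIndex Sᶜ k, blockIndex (leftDescents ρ) (ρ k))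

/-- The diagram `D_{σ;S}`: its boxes are the `(i, j)` for which some position `k` lies in the `j`th
block of positions counted from the end, cut after the elements of `S`, while the value `σ k` lies
in the `i`th block of values, cut after the elements that are not left descents of `σ`. -/
noncomputable def upperDiagram {n : ℕ} (σ : Equiv.Perm (Fin n)) (S : Finset (Fin (n - 1))) :
    Finset (ℕ × ℕ) :=
  Finset.univ.image fun k : Fin n =>
    (blockIndex (leftDescents σ)ᶜ (σ k), S.card + 2 - blockIndex S k)

/-! ### Standard fillings, reading words and tableaux -/

/-- A standard filling of `D`. -/
abbrev Filling (n : ℕ) (D : Finset (ℕ × ℕ)) : Type := {b // b ∈ D} ≃ Fin n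

/-- The filling of the `n` boxes of `D` with `1, …, n` in the increasing order of an injective
key. -/
noncomputable def fillingOf {L : Type} [LinearOrder L] {n : ℕ} (key : ℕ × ℕ ↪ L)
    (D : Finset (ℕ × ℕ)) (hD : D.card = n) : Filling n D :=
  (Equiv.ofBijective
      (fun b : {b // b ∈ D} => (⟨key b.1, Finset.mem_map_of_mem key b.2⟩ : {l // l ∈ D.map key}))
      ⟨fun a b h => Subtype.ext (key.injective (congrArg Subtype.val h)),
        fun l => by
          obtain ⟨b, hb, h⟩ := Finset.mem_map.mp l.2
          exact ⟨⟨b, hb⟩, Subtype.ext h⟩⟩).trans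
    ((D.map key).orderIsoOfFin (by rw [Finset.card_map, hD])).toEquiv.symm

/-- Columns from left to right, each column from top to bottom. -/
def keyTBLR : ℕ × ℕ ↪ ℕ ×ₗ ℕᵒᵈ :=
  ⟨fun b => toLex (b.1, OrderDual.toDual b.2), fun _ _ h => h⟩

/-- Columns from left to right, each column from bottom to top. -/
def keyBTLR : ℕ × ℕ ↪ ℕ ×ₗ ℕ :=
  ⟨fun b => toLex (b.1, b.2), fun _ _ h => h⟩

/-- Rows from top to bottom, each row from left to right. -/
def keyLRTB : ℕ × ℕ ↪ ℕᵒᵈ ×ₗ ℕ :=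
  ⟨fun b => toLex (OrderDual.toDual b.2, b.1), fun a b h => by
    have h1 := congrArg (fun p => (ofLex p).1) h
    have h2 := congrArg (fun p => (ofLex p).2) h
    exact Prod.ext h2 h1⟩

/-- Rows from bottom to top, each row from left to right. -/
def keyLRBT : ℕ × ℕ ↪ ℕ ×ₗ ℕ :=
  ⟨fun b => toLex (b.2, b.1), fun a b h => by
    have h1 := congrArg (fun p => (ofLex p).1) h
    have h2 := congrArg (fun p => (ofLex p).2) h
    exact Prod.ext h2 h1⟩

/-- The filling `F_D^↓`. -/
noncomputable def fillDown {n : ℕ} (D : Finset (ℕ × ℕ)) (hD : D.card = n) : Filling n D :=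
  fillingOf keyTBLR D hD

/-- The filling `F_D^→`. -/
noncomputable def fillRight {n : ℕ} (D : Finset (ℕ × ℕ)) (hD : D.card = n) : Filling n D :=
  fillingOf keyLRTB D hD

/-- The standard tableau `T'_D`: columns from left to right, each filled from bottom to top. -/
noncomputable def colTableau {n : ℕ} (D : Finset (ℕ × ℕ)) (hD : D.card = n) : Filling n D :=
  fillingOf keyBTLR D hD

/-- The standard tableau `T_D`: rows from bottom to top, each filled from left to right. -/
noncomputable def rowTableau {n : ℕ} (D : Finset (ℕ × ℕ)) (hD : D.card = n) : Filling n D :=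
  fillingOf keyLRBT D hD

/-- The word of the entries of `F`, read down the columns, from the leftmost column on. The `k`th
letter is the entry of `F` in the `k`th box in this order. -/
noncomputable def readTBLR {n : ℕ} {D : Finset (ℕ × ℕ)} (hD : D.card = n) (F : Filling n D) :
    Equiv.Perm (Fin n) :=
  (fillingOf keyTBLR D hD).symm.trans F

/-- The word of the entries of `F`, read from left to right along the rows, from the top row on. -/
noncomputable def readLRTB {n : ℕ} {D : Finset (ℕ × ℕ)} (hD : D.card = n) (F : Filling n D) :
    Equiv.Perm (Fin n) :=
  (fillingOf keyLRTB D hD).symm.trans F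

/-- The poset `P_F` on the letters: `i ≤ j` if and only if the box of `i` is weakly to the left of
and weakly below the box of `j`. -/
abbrev posetOf {n : ℕ} {D : Finset (ℕ × ℕ)} (F : Filling n D) : PartialOrder (Fin n) :=
  PartialOrder.lift (fun i => (F.symm i : ℕ × ℕ))
    (Subtype.val_injective.comp F.symm.injective)

/-- The set `Σ_L(P)`. -/
def linearExtensions {n : ℕ} (P : PartialOrder (Fin n)) : Set (Equiv.Perm (Fin n)) :=
  {σ | ∀ i j, P.le i j → σ i ≤ σ j}

/-- The set of standard tableaux on `D`. -/
abbrev StandardTableau (n : ℕ) (D : Finset (ℕ × ℕ)) : Type :=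
  {T : Filling n D // ∀ b c : {b // b ∈ D}, (b : ℕ × ℕ) ≤ c → T b ≤ T c}

/-- Reflection in a horizontal line, exchanging the rows `1, …, r`. -/
def flipBox (r : ℕ) (b : ℕ × ℕ) : ℕ × ℕ := (b.1, r + 1 - b.2)

/-- The reflected diagram `D^x`. -/
def reflectX (D : Finset (ℕ × ℕ)) : Finset (ℕ × ℕ) := D.image (flipBox (numRows D))

theorem IsDiagram.flipBox_injOn {n : ℕ} {D : Finset (ℕ × ℕ)} (hD : IsDiagram n D) :
    Set.InjOn (flipBox (numRows D)) D := by
  intro a ha b hb h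
  have key : ∀ c ∈ D, 1 ≤ c.2 ∧ c.2 ≤ numRows D := fun c hc =>
    Finset.mem_Icc.mp (hD.rows_eq ▸ Finset.mem_image_of_mem Prod.snd hc)
  have h1 := key a ha
  have h2 := key b hb
  simp only [flipBox, Prod.mk.injEq] at h
  exact Prod.ext h.1 (by omega)

theorem IsDiagram.card_reflectX {n : ℕ} {D : Finset (ℕ × ℕ)} (hD : IsDiagram n D) :
    (reflectX D).card = n :=
  (Finset.card_image_of_injOn hD.flipBox_injOn).trans hD.card_eq

/-- The reflection as a bijection from the boxes of `D` to those of `D^x`. -/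
noncomputable def flipEquiv {n : ℕ} {D : Finset (ℕ × ℕ)} (hD : IsDiagram n D) :
    {b // b ∈ D} ≃ {b // b ∈ reflectX D} :=
  Equiv.ofBijective
    (fun b => ⟨flipBox (numRows D) b.1, Finset.mem_image_of_mem _ b.2⟩)
    ⟨fun a b h => Subtype.ext (hD.flipBox_injOn a.2 b.2 (congrArg Subtype.val h)),
      fun c => by
        obtain ⟨b, hb, h⟩ := Finset.mem_image.mp c.2
        exact ⟨⟨b, hb⟩, Subtype.ext h⟩⟩

/-- For a filling `T` of `D^x`, the reflected filling `T^x` of `D = (D^x)^x`. -/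
noncomputable def reflectFilling {n : ℕ} {D : Finset (ℕ × ℕ)} (hD : IsDiagram n D)
    (T : Filling n (reflectX D)) : Filling n D :=
  (flipEquiv hD).trans T

/-- The order on standard tableaux by the left weak order of the column reading words. -/
def TableauLE {n : ℕ} {D : Finset (ℕ × ℕ)} (hD : D.card = n) (T U : StandardTableau n D) : Prop :=
  LeftLE (readTBLR hD T.1) (readTBLR hD U.1)

/-- The set `{Σ_L(P_{T^x}) : T a standard tableau on D^x}`. -/
def tableauIntervals {n : ℕ} {D : Finset (ℕ × ℕ)} (hD : IsDiagram n D) :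
    Set (Set (Equiv.Perm (Fin n))) :=
  Set.range fun T : StandardTableau n (reflectX D) =>
    linearExtensions (posetOf (reflectFilling hD T.1))

/-- The set `C` with the order `⪯` is isomorphic, as a poset, to the set of standard tableaux on
`D^x` with the order of their reading words. -/
def IsoToTableaux {n : ℕ} {D : Finset (ℕ × ℕ)} (hD : IsDiagram n D)
    (C : Set (Set (Equiv.Perm (Fin n)))) : Prop :=
  Nonempty (RelIso (fun I J : C => IntervalLE (I : Set (Equiv.Perm (Fin n))) J)
    (TableauLE (n := n) (D := reflectX D) hD.card_reflectX))

end WeakBruhat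

/-!
An interval `[σ, ρ]_L` is the set of linear extensions of the poset on positions in which `p ≤ q`
means `σ p ≤ σ q` and `ρ p ≤ ρ q` (`mem_leftInterval_iff`, from the description of the weak order by
inclusion of inversions, `leftLE_iff`). A covering step of the left weak order creates exactly one
left descent, the index of the step. So a descent-preserving isomorphism of intervals commutes with
all steps, and it is a right translation `γ ↦ γ * π` (`exists_translation_of_descentIso`): an
equivalence class consists of intervals of linear extensions of one abstract poset `Q`, for various
labellings of `Q` by positions. What distinguishes a class is which elements with consecutive values
are in descending order of labels.

For `[w0 S, ρ]_L` the poset `Q` is the set of boxes of the diagram `D` with the product order, and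
its labelling is `fillDown D` (`lower_descent_interval`); for `[σ, w1 S]_L` it is that of the other
diagram with the labelling `fillRight` (`upper_descent_interval`). Both labellings increase to the
right and downwards (`SoutheastIncreasing`). If `D` is free of strictly upper-right pairs, then two
boxes with consecutive entries of a standard tableau on `D` never lie strictly to the upper right of
one another, so one is weakly southeast of the other, and all southeast-increasing labellings give
the same descents and lie in the same class (`descentIso_of_southeastIncreasing`). Conversely, two
boxes that span a rectangle, from northwest to southeast, without further boxes have consecutive
entries in some standard tableau (`exists_consecutive_tableau`), so that the descents force their
labels to increase in this direction; hence the class consists of the southeast-increasing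
labellings (`descentClass_eq_tableauIntervals`), and these are the reflections of the standard
tableaux on `D^x`.

The interval of a southeast-increasing labelling `F` reaches from the column tableau to the row
tableau, both read in the order of `F` (`linearExtensions_eq_leftInterval`). The inverse of its
bottom is the column reading word of the reflected tableau (`bottomPerm_reflectFilling_inv`), which
identifies the order on the class with the order on tableaux and shows that `fillRight` gives its
maximum and `fillDown` its minimum. Finally, `w0` and `w1` are recognized by their inversions
(`w0_lt_iff`, `w1_lt_iff`).
-/

namespace WeakBruhat

/-! ### Inversions and the weak orders -/

section Inversions

variable {n : ℕ}

/-- The smaller of the two letters exchanged by `simpleTransp i`. -/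
def lowLetter (i : Fin (n - 1)) : Fin n := ⟨i.val, by omega⟩

/-- The larger of the two letters exchanged by `simpleTransp i`. -/
def highLetter (i : Fin (n - 1)) : Fin n := ⟨i.val + 1, by omega⟩

@[simp] theorem lowLetter_val (i : Fin (n - 1)) : (lowLetter i).val = i.val := rfl

@[simp] theorem highLetter_val (i : Fin (n - 1)) : (highLetter i).val = i.val + 1 := rfl

theorem simpleTransp_eq (i : Fin (n - 1)) :
    simpleTransp i = Equiv.swap (lowLetter i) (highLetter i) := rfl

@[simp] theorem simpleTransp_low (i : Fin (n - 1)) :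
    simpleTransp i (lowLetter i) = highLetter i := Equiv.swap_apply_left _ _

@[simp] theorem simpleTransp_high (i : Fin (n - 1)) :
    simpleTransp i (highLetter i) = lowLetter i := Equiv.swap_apply_right _ _

@[simp] theorem simpleTransp_mul_self (i : Fin (n - 1)) :
    simpleTransp i * simpleTransp i = 1 := Equiv.swap_mul_self _ _

@[simp] theorem simpleTransp_inv (i : Fin (n - 1)) : (simpleTransp i)⁻¹ = simpleTransp i :=
  Equiv.swap_inv _ _

theorem simpleTransp_mul_cancel (i : Fin (n - 1)) (σ : Equiv.Perm (Fin n)) :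
    simpleTransp i * (simpleTransp i * σ) = σ := by
  rw [← mul_assoc, simpleTransp_mul_self, one_mul]

theorem lowLetter_lt_highLetter (i : Fin (n - 1)) : lowLetter i < highLetter i := by
  exact Nat.lt_succ_self _

theorem simpleTransp_lt (i : Fin (n - 1)) {x y : Fin n} (h : x < y)
    (hxy : ¬(x = lowLetter i ∧ y = highLetter i)) : simpleTransp i x < simpleTransp i y := by
  rw [simpleTransp_eq, Equiv.swap_apply_def, Equiv.swap_apply_def]
  split_ifs <;> simp only [Fin.ext_iff, Fin.lt_def, lowLetter_val, highLetter_val] at * <;> omega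

/-- A transitive relation that holds between neighbours all the way from `p` to `q` holds between
`p` and `q`. -/
theorem rel_of_consecutive (r : Fin n → Fin n → Prop) (ht : ∀ a b c, r a b → r b c → r a c)
    {p q : Fin n} (hpq : p < q)
    (h : ∀ i : Fin (n - 1), p.val ≤ i.val → i.val < q.val → r (lowLetter i) (highLetter i)) :
    r p q := by
  obtain ⟨p, hp⟩ := p
  obtain ⟨q, hq⟩ := q
  simp only [Fin.lt_def] at hpq h
  induction q, hpq using Nat.le_induction with
  | base => exact h ⟨p, by omega⟩ le_rfl (Nat.lt_succ_self p)
  | succ q hpq ih =>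
    exact ht _ _ _ (ih (by omega) fun i h1 h2 => h i h1 (by omega))
      (h ⟨q, by omega⟩ (by dsimp only; omega) (Nat.lt_succ_self q))

/-- A bijection onto `Fin n` is determined by the order that it induces. -/
theorem equiv_eq_of_le_iff {α : Type*} (e f : α ≃ Fin n)
    (h : ∀ a b, e a ≤ e b ↔ f a ≤ f b) : e = f := by
  let o : Fin n ≃o Fin n :=
    { toEquiv := e.symm.trans f
      map_rel_iff' := fun {a b} => by simp [← h] }
  have ho : o = OrderIso.refl _ := Subsingleton.elim _ _
  ext1 a
  have := DFunLike.congr_fun ho (e a)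
  simpa [o] using this.symm

theorem equiv_eq_of_lt_iff {α : Type*} (e f : α ≃ Fin n)
    (h : ∀ a b, e a < e b ↔ f a < f b) : e = f :=
  equiv_eq_of_le_iff e f fun a b => by rw [← not_lt, ← not_lt, h]

/-- The pairs of positions whose letters are out of order. -/
def inversions (σ : Equiv.Perm (Fin n)) : Finset (Fin n × Fin n) :=
  Finset.univ.filter fun p => p.1 < p.2 ∧ σ p.2 < σ p.1

@[simp] theorem mem_inversions {σ : Equiv.Perm (Fin n)} {p : Fin n × Fin n} :
    p ∈ inversions σ ↔ p.1 < p.2 ∧ σ p.2 < σ p.1 := by simp [inversions]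

theorem eq_of_inversions_eq {σ τ : Equiv.Perm (Fin n)} (h : inversions σ = inversions τ) :
    σ = τ := by
  have key : ∀ p q : Fin n, p < q → (σ q < σ p ↔ τ q < τ p) := fun p q hpq => by
    simpa [hpq] using Finset.ext_iff.mp h (p, q)
  refine equiv_eq_of_lt_iff σ τ fun p q => ?_
  rcases lt_trichotomy p q with hpq | rfl | hpq
  · have := key p q hpq
    have h1 : σ p ≠ σ q := fun h => hpq.ne (σ.injective h)
    have h2 : τ p ≠ τ q := fun h => hpq.ne (τ.injective h)
    constructor <;> intro h3
    · exact lt_of_le_of_ne (not_lt.mp fun h4 => h3.asymm (this.mpr h4)) h2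
    · exact lt_of_le_of_ne (not_lt.mp fun h4 => h3.asymm (this.mp h4)) h1
  · simp
  · exact key q p hpq

theorem letters_notMem_inversions {σ : Equiv.Perm (Fin n)} {i : Fin (n - 1)} :
    (σ.symm (lowLetter i), σ.symm (highLetter i)) ∉ inversions σ := by
  simp [(lowLetter_lt_highLetter i).le]

theorem inversions_simpleTransp_mul {σ : Equiv.Perm (Fin n)} {i : Fin (n - 1)}
    (h : σ.symm (lowLetter i) < σ.symm (highLetter i)) :
    inversions (simpleTransp i * σ) =
      insert (σ.symm (lowLetter i), σ.symm (highLetter i)) (inversions σ) := by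
  ext ⟨p, q⟩
  simp only [mem_inversions, Finset.mem_insert, Prod.mk.injEq, Equiv.Perm.mul_apply]
  constructor
  · rintro ⟨hpq, h1⟩
    by_cases h2 : σ p = lowLetter i ∧ σ q = highLetter i
    · left
      simp [← h2.1, ← h2.2]
    · refine Or.inr ⟨hpq, ?_⟩
      by_contra h3
      have h4 : σ p < σ q := lt_of_le_of_ne (not_lt.mp h3) fun h => hpq.ne (σ.injective h)
      exact (simpleTransp_lt i h4 h2).asymm h1
  · rintro (⟨rfl, rfl⟩ | ⟨hpq, h1⟩)
    · simpa using ⟨h, lowLetter_lt_highLetter i⟩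
    · refine ⟨hpq, simpleTransp_lt i h1 ?_⟩
      rintro ⟨h2, h3⟩
      rw [← h2, ← h3] at h
      simp only [Equiv.symm_apply_apply] at h
      exact h.asymm hpq

theorem card_inversions_simpleTransp_mul {σ : Equiv.Perm (Fin n)} {i : Fin (n - 1)}
    (h : σ.symm (lowLetter i) < σ.symm (highLetter i)) :
    (inversions (simpleTransp i * σ)).card = (inversions σ).card + 1 := by
  rw [inversions_simpleTransp_mul h, Finset.card_insert_of_notMem letters_notMem_inversions]

theorem card_inversions_of_gt {σ : Equiv.Perm (Fin n)} {i : Fin (n - 1)}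
    (h : σ.symm (highLetter i) < σ.symm (lowLetter i)) :
    (inversions σ).card = (inversions (simpleTransp i * σ)).card + 1 := by
  have := card_inversions_simpleTransp_mul (σ := simpleTransp i * σ) (i := i)
    (by
      change σ.symm ((simpleTransp i)⁻¹ _) < σ.symm ((simpleTransp i)⁻¹ _)
      simpa using h)
  rwa [simpleTransp_mul_cancel] at this

theorem lt_or_gt_letters (σ : Equiv.Perm (Fin n)) (i : Fin (n - 1)) :
    σ.symm (lowLetter i) < σ.symm (highLetter i) ∨ σ.symm (highLetter i) < σ.symm (lowLetter i) :=
  lt_or_gt_of_ne fun h => (lowLetter_lt_highLetter i).ne (σ.symm.injective h)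

/-- If `ρ * σ⁻¹` inverts no pair of neighbouring letters, then it is the identity. -/
theorem exists_consecutive_gt {σ ρ : Equiv.Perm (Fin n)} (h : σ ≠ ρ) :
    ∃ i : Fin (n - 1), ρ (σ.symm (highLetter i)) < ρ (σ.symm (lowLetter i)) := by
  by_contra! hc
  refine h ?_
  have hlt : ∀ i : Fin (n - 1), ρ (σ.symm (lowLetter i)) < ρ (σ.symm (highLetter i)) := fun i =>
    lt_of_le_of_ne (hc i) fun h =>
      (lowLetter_lt_highLetter i).ne (σ.symm.injective (ρ.injective h))
  have hmono : StrictMono fun x => ρ (σ.symm x) := fun p q hpq =>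
    rel_of_consecutive (fun a b => ρ (σ.symm a) < ρ (σ.symm b)) (fun _ _ _ => lt_trans) hpq
      fun i _ _ => hlt i
  refine equiv_eq_of_lt_iff σ ρ fun p q => ?_
  simpa using (hmono.lt_iff_lt (a := σ p) (b := σ q)).symm

theorem exists_word (σ : Equiv.Perm (Fin n)) :
    ∃ l : List (Fin (n - 1)), l.length = (inversions σ).card ∧ (l.map simpleTransp).prod = σ := by
  induction hk : (inversions σ).card generalizing σ with
  | zero =>
    refine ⟨[], rfl, ?_⟩
    by_contra hne
    obtain ⟨i, hi⟩ := exists_consecutive_gt (σ := σ) (ρ := 1) fun h => hne (by simp [h])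
    have := card_inversions_of_gt (σ := σ) (i := i) hi
    omega
  | succ k ih =>
    have hne : σ ≠ 1 := by
      rintro rfl
      have : inversions (1 : Equiv.Perm (Fin n)) = ∅ := by
        ext p
        simpa using fun h : p.1 < p.2 => h.le
      simp [this] at hk
    obtain ⟨i, hi⟩ := exists_consecutive_gt (σ := σ) (ρ := 1) hne
    have h1 := card_inversions_of_gt (σ := σ) (i := i) hi
    obtain ⟨l, hl, hp⟩ := ih (simpleTransp i * σ) (by omega)
    exact ⟨i :: l, by simp [hl], by simp [hp, simpleTransp_mul_cancel]⟩

theorem card_inversions_le (l : List (Fin (n - 1))) :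
    (inversions (l.map simpleTransp).prod).card ≤ l.length := by
  induction l with
  | nil =>
    have : inversions (1 : Equiv.Perm (Fin n)) = ∅ := by
      ext p
      simpa using fun h : p.1 < p.2 => h.le
    simp [this]
  | cons i l ih =>
    simp only [List.map_cons, List.prod_cons, List.length_cons]
    rcases lt_or_gt_letters (l.map simpleTransp).prod i with h | h
    · rw [card_inversions_simpleTransp_mul h]
      omega
    · have := card_inversions_of_gt h
      omega

theorem length_eq_card_inversions (σ : Equiv.Perm (Fin n)) :
    length σ = (inversions σ).card := by
  refine le_antisymm (Nat.sInf_le (exists_word σ)) ?_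
  refine le_csInf ⟨_, exists_word σ⟩ ?_
  rintro k ⟨l, rfl, rfl⟩
  exact card_inversions_le l

theorem length_inv (σ : Equiv.Perm (Fin n)) : length σ⁻¹ = length σ := by
  have key : ∀ τ : Equiv.Perm (Fin n), length τ⁻¹ ≤ length τ := fun τ => by
    obtain ⟨l, hl, hp⟩ := exists_word τ
    rw [length_eq_card_inversions τ, ← hl]
    refine Nat.sInf_le ⟨l.reverse, by simp, ?_⟩
    rw [← hp, List.prod_inv_reverse, List.map_reverse, List.map_map]
    congr 2
  exact le_antisymm (key σ) (by simpa using key σ⁻¹)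

theorem mem_leftDescents {σ : Equiv.Perm (Fin n)} {i : Fin (n - 1)} :
    i ∈ leftDescents σ ↔ σ.symm (highLetter i) < σ.symm (lowLetter i) := by
  simp only [leftDescents, Finset.mem_filter, Finset.mem_univ, true_and,
    length_eq_card_inversions]
  rcases lt_or_gt_letters σ i with h | h
  · rw [card_inversions_simpleTransp_mul h]
    simpa using h.le
  · have := card_inversions_of_gt h
    simp only [h, iff_true]
    omega

theorem rightDescents_eq (σ : Equiv.Perm (Fin n)) : rightDescents σ = leftDescents σ⁻¹ := by
  ext i
  have : length (σ * simpleTransp i) = length (simpleTransp i * σ⁻¹) := by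
    rw [← length_inv, mul_inv_rev, simpleTransp_inv]
  simp [rightDescents, leftDescents, this, length_inv]

theorem mem_rightDescents {σ : Equiv.Perm (Fin n)} {i : Fin (n - 1)} :
    i ∈ rightDescents σ ↔ σ (highLetter i) < σ (lowLetter i) := by
  rw [rightDescents_eq, mem_leftDescents]
  rfl

theorem inversions_cover {σ : Equiv.Perm (Fin n)} {i : Fin (n - 1)} (h : i ∉ leftDescents σ) :
    inversions (simpleTransp i * σ) =
      insert (σ.symm (lowLetter i), σ.symm (highLetter i)) (inversions σ) :=
  inversions_simpleTransp_mul
    ((lt_or_gt_letters σ i).resolve_right fun h1 => h (mem_leftDescents.mpr h1))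

/-- Take a pair of neighbouring letters that `ρ * σ⁻¹` inverts: exchanging them in `σ` creates one
inversion, and this is an inversion of `ρ`. -/
theorem exists_cover_of_inversions_subset {σ ρ : Equiv.Perm (Fin n)}
    (h : inversions σ ⊆ inversions ρ) (hne : σ ≠ ρ) :
    ∃ i, i ∉ leftDescents σ ∧ inversions (simpleTransp i * σ) ⊆ inversions ρ := by
  obtain ⟨i, hi⟩ := exists_consecutive_gt hne
  have hlt : σ.symm (lowLetter i) < σ.symm (highLetter i) := by
    refine (lt_or_gt_letters σ i).resolve_right fun h1 => ?_
    have h2 : (σ.symm (highLetter i), σ.symm (lowLetter i)) ∈ inversions σ := by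
      simpa using ⟨h1, lowLetter_lt_highLetter i⟩
    exact (mem_inversions.mp (h h2)).2.asymm hi
  refine ⟨i, fun h1 => hlt.asymm (mem_leftDescents.mp h1), ?_⟩
  rw [inversions_simpleTransp_mul hlt]
  exact Finset.insert_subset (mem_inversions.mpr ⟨hlt, hi⟩) h

theorem leftLE_iff_inversions_subset {σ ρ : Equiv.Perm (Fin n)} :
    LeftLE σ ρ ↔ inversions σ ⊆ inversions ρ := by
  constructor
  · intro h
    induction h with
    | refl => exact Finset.Subset.refl _
    | tail _ h ih =>
      obtain ⟨i, hi, rfl⟩ := h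
      rw [inversions_cover hi]
      exact ih.trans (Finset.subset_insert _ _)
  · intro h
    induction hk : (inversions ρ).card - (inversions σ).card using Nat.strong_induction_on
      generalizing σ with
    | _ k ih =>
      by_cases hne : σ = ρ
      · exact hne ▸ Relation.ReflTransGen.refl
      · obtain ⟨i, hi, hs⟩ := exists_cover_of_inversions_subset h hne
        have h1 : (inversions (simpleTransp i * σ)).card = (inversions σ).card + 1 := by
          rw [inversions_cover hi, Finset.card_insert_of_notMem letters_notMem_inversions]
        have h2 := Finset.card_le_card hs
        exact Relation.ReflTransGen.head ⟨i, hi, rfl⟩ (ih _ (by omega) hs rfl)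

theorem leftLE_iff {σ ρ : Equiv.Perm (Fin n)} :
    LeftLE σ ρ ↔ ∀ p q, p < q → σ q < σ p → ρ q < ρ p := by
  rw [leftLE_iff_inversions_subset]
  constructor
  · exact fun h p q h1 h2 => (mem_inversions.mp (h (mem_inversions.mpr (And.intro h1 h2 :
      (p, q).1 < (p, q).2 ∧ _)))).2
  · rintro h ⟨p, q⟩ hp
    have := mem_inversions.mp hp
    exact mem_inversions.mpr ⟨this.1, h p q this.1 this.2⟩

theorem LeftLE.refl (σ : Equiv.Perm (Fin n)) : LeftLE σ σ := Relation.ReflTransGen.refl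

theorem LeftLE.trans {σ τ ρ : Equiv.Perm (Fin n)} (h : LeftLE σ τ) (h' : LeftLE τ ρ) :
    LeftLE σ ρ := Relation.ReflTransGen.trans h h'

theorem LeftLE.antisymm {σ ρ : Equiv.Perm (Fin n)} (h : LeftLE σ ρ) (h' : LeftLE ρ σ) : σ = ρ :=
  eq_of_inversions_eq ((leftLE_iff_inversions_subset.mp h).antisymm
    (leftLE_iff_inversions_subset.mp h'))

theorem leftLE_simpleTransp_mul {σ : Equiv.Perm (Fin n)} {i : Fin (n - 1)}
    (h : i ∉ leftDescents σ) : LeftLE σ (simpleTransp i * σ) :=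
  Relation.ReflTransGen.single ⟨i, h, rfl⟩

theorem rightLE_iff {σ ρ : Equiv.Perm (Fin n)} : RightLE σ ρ ↔ LeftLE σ⁻¹ ρ⁻¹ := by
  constructor <;> intro h
  · induction h with
    | refl => exact LeftLE.refl _
    | tail _ h ih =>
      obtain ⟨i, hi, rfl⟩ := h
      exact ih.tail ⟨i, by rwa [← rightDescents_eq], by simp [mul_inv_rev]⟩
  · rw [← inv_inv σ, ← inv_inv ρ]
    generalize σ⁻¹ = σ', ρ⁻¹ = ρ' at h ⊢
    induction h with
    | refl => exact Relation.ReflTransGen.refl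
    | tail _ h ih =>
      obtain ⟨i, hi, rfl⟩ := h
      exact ih.tail ⟨i, by rwa [rightDescents_eq, inv_inv], by simp [mul_inv_rev]⟩

end Inversions

/-! ### Weak Bruhat intervals as sets of linear extensions -/

section Intervals

variable {n : ℕ}

theorem perm_lt_of_le_of_ne {σ : Equiv.Perm (Fin n)} {p q : Fin n} (h : σ p ≤ σ q) (hne : p ≠ q) :
    σ p < σ q := lt_of_le_of_ne h fun h => hne (σ.injective h)

/-- The interval `[σ, ρ]_L` consists of the linear extensions of the intersection of the linear
orders given by `σ` and `ρ`. -/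
theorem mem_leftInterval_iff {σ ρ γ : Equiv.Perm (Fin n)} (h : LeftLE σ ρ) :
    γ ∈ leftInterval σ ρ ↔ ∀ p q, σ p ≤ σ q → ρ p ≤ ρ q → γ p ≤ γ q := by
  simp only [leftInterval, Set.mem_ofPred_eq]
  rw [leftLE_iff] at h
  rw [leftLE_iff, leftLE_iff]
  constructor
  · rintro ⟨h1, h2⟩ p q hσ hρ
    by_contra! hγ
    rcases lt_trichotomy p q with hpq | rfl | hpq
    · exact (h2 p q hpq hγ).not_ge hρ
    · exact hγ.false
    · exact (h1 q p hpq (perm_lt_of_le_of_ne hσ hpq.ne')).asymm hγ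
  · intro hγ
    refine ⟨fun p q hpq hσ => ?_, fun p q hpq h1 => ?_⟩
    · exact perm_lt_of_le_of_ne (hγ q p hσ.le (h p q hpq hσ).le) hpq.ne'
    · by_contra! h2
      refine (hγ p q ?_ h2).not_gt h1
      by_contra! h3
      exact (h p q hpq h3).not_ge h2

theorem left_mem_leftInterval {σ ρ : Equiv.Perm (Fin n)} (h : LeftLE σ ρ) :
    σ ∈ leftInterval σ ρ := ⟨LeftLE.refl _, h⟩

theorem bottom_unique {σ ρ σ' ρ' : Equiv.Perm (Fin n)} (h : LeftLE σ ρ) (h' : LeftLE σ' ρ')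
    (heq : leftInterval σ ρ = leftInterval σ' ρ') : σ = σ' := by
  have h1 : σ ∈ leftInterval σ' ρ' := heq ▸ left_mem_leftInterval h
  have h2 : σ' ∈ leftInterval σ ρ := heq ▸ left_mem_leftInterval h'
  exact h2.1.antisymm h1.1

theorem intervalLE_iff {σ ρ σ' ρ' : Equiv.Perm (Fin n)} (h : LeftLE σ ρ) (h' : LeftLE σ' ρ') :
    IntervalLE (leftInterval σ ρ) (leftInterval σ' ρ') ↔ RightLE σ σ' := by
  constructor
  · rintro ⟨a, b, c, d, hab, h1, hcd, h2, hle⟩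
    rwa [bottom_unique h hab h1, bottom_unique h' hcd h2]
  · exact fun hle => ⟨σ, ρ, σ', ρ', h, rfl, h', rfl, hle⟩

end Intervals

/-! ### The permutations `w0 S` and `w1 S` -/

section Longest

variable {n : ℕ}

theorem longest_mem (A : Set (Equiv.Perm (Fin n))) (hA : A.Nonempty) : longest A hA ∈ A :=
  (Set.exists_max_image A length A.toFinite hA).choose_spec.1

theorem length_le_longest (A : Set (Equiv.Perm (Fin n))) (hA : A.Nonempty)
    {σ : Equiv.Perm (Fin n)} (hσ : σ ∈ A) : length σ ≤ length (longest A hA) :=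
  (Set.exists_max_image A length A.toFinite hA).choose_spec.2 σ hσ

theorem length_lt_mul_simpleTransp {σ : Equiv.Perm (Fin n)} {i : Fin (n - 1)}
    (h : i ∉ rightDescents σ) : length σ < length (σ * simpleTransp i) := by
  rw [rightDescents_eq] at h
  rw [← length_inv σ, ← length_inv (σ * _), mul_inv_rev, simpleTransp_inv,
    length_eq_card_inversions, length_eq_card_inversions, inversions_cover h,
    Finset.card_insert_of_notMem letters_notMem_inversions]
  exact Nat.lt_succ_self _

/-- The parabolic subgroup of `S` preserves the blocks cut after the elements outside `S`. -/
theorem lt_apply_iff_of_mem_parabolic {S : Finset (Fin (n - 1))} {w : Equiv.Perm (Fin n)}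
    (hw : w ∈ parabolic S) {z : Fin (n - 1)} (hz : z ∉ S) (p : Fin n) :
    z.val < (w p).val ↔ z.val < p.val := by
  induction hw using Subgroup.closure_induction generalizing p with
  | mem w hw =>
    obtain ⟨i, hi, rfl⟩ := hw
    have hne : z.val ≠ i.val := fun h => hz (Fin.ext h ▸ hi)
    rw [simpleTransp_eq, Equiv.swap_apply_def]
    split_ifs with h1 h2
    · subst h1
      simp only [lowLetter_val, highLetter_val]
      omega
    · subst h2
      simp only [lowLetter_val, highLetter_val]
      omega
    · rfl
  | one => rfl
  | mul a b _ _ iha ihb => rw [Equiv.Perm.mul_apply, iha, ihb]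
  | inv a _ ih => simpa using (ih (a⁻¹ p)).symm

/-- `w0 S` reverses every block cut after the elements outside `S`. -/
theorem w0_lt_iff {S : Finset (Fin (n - 1))} {p q : Fin n} (hpq : p < q) :
    w0 S p < w0 S q ↔ ∃ z, z ∉ S ∧ p.val ≤ z.val ∧ z.val < q.val := by
  have hmem : w0 S ∈ parabolic S := longest_mem (parabolic S : Set (Equiv.Perm (Fin n))) _
  constructor
  · intro h
    by_contra! hc
    refine h.asymm (rel_of_consecutive (fun a b => w0 S b < w0 S a)
      (fun _ _ _ h1 h2 => h2.trans h1) hpq fun i h1 h2 => ?_)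
    have hi : i ∈ S := by
      by_contra hi
      exact (hc i hi h1).not_gt h2
    refine mem_rightDescents.mp ?_
    by_contra hd
    refine (length_lt_mul_simpleTransp hd).not_ge (length_le_longest _ _ ?_)
    exact (parabolic S).mul_mem hmem (Subgroup.subset_closure (Set.mem_image_of_mem _ hi))
  · rintro ⟨z, hz, h1, h2⟩
    have h3 := (lt_apply_iff_of_mem_parabolic hmem hz p).not
    have h4 := lt_apply_iff_of_mem_parabolic hmem hz q
    rw [Fin.lt_def]
    omega

/-- The reversal of `w0 Sᶜ` inverts all pairs of positions in different blocks cut after the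
elements of `S`; these are all the pairs that an element of `minCosetReps Sᶜ` can invert. -/
theorem w1_eq (S : Finset (Fin (n - 1))) : w1 S = Fin.revPerm * w0 Sᶜ := by
  have hmem : w1 S ∈ minCosetReps Sᶜ := longest_mem _ (minCosetReps_nonempty _)
  have hu : ∀ p q : Fin n, p < q → ((Fin.revPerm * w0 Sᶜ : Equiv.Perm (Fin n)) q <
      (Fin.revPerm * w0 Sᶜ : Equiv.Perm (Fin n)) p ↔ ∃ z ∈ S, p.val ≤ z.val ∧ z.val < q.val) :=
      fun p q hpq => by
    rw [Equiv.Perm.mul_apply, Equiv.Perm.mul_apply, Fin.revPerm_apply, Fin.revPerm_apply,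
      Fin.rev_lt_rev, w0_lt_iff hpq]
    simp
  refine eq_of_inversions_eq (Finset.eq_of_subset_of_card_le ?_ ?_)
  · rintro ⟨p, q⟩ h
    obtain ⟨hpq, h⟩ := mem_inversions.mp h
    refine mem_inversions.mpr ⟨hpq, (hu p q hpq).mpr ?_⟩
    by_contra! hc
    refine h.asymm (rel_of_consecutive (fun a b => w1 S a < w1 S b)
      (fun _ _ _ => lt_trans) hpq fun i h1 h2 => ?_)
    have hi : i ∉ S := fun hi => (hc i hi h1).not_gt h2
    have hd : i ∉ rightDescents (w1 S) := fun hd => hi (by simpa using hmem hd)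
    rw [mem_rightDescents, not_lt] at hd
    exact perm_lt_of_le_of_ne hd (lowLetter_lt_highLetter i).ne
  · rw [← length_eq_card_inversions, ← length_eq_card_inversions]
    refine length_le_longest _ _ fun i hi => ?_
    obtain ⟨z, hz, h1, h2⟩ := (hu _ _ (lowLetter_lt_highLetter i)).mp (mem_rightDescents.mp hi)
    have : z = i := Fin.ext (by simp only [lowLetter_val, highLetter_val] at h1 h2; omega)
    simpa [← this] using hz

theorem w1_lt_iff {S : Finset (Fin (n - 1))} {p q : Fin n} (hpq : p < q) :
    w1 S q < w1 S p ↔ ∃ z, z ∈ S ∧ p.val ≤ z.val ∧ z.val < q.val := by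
  rw [w1_eq, Equiv.Perm.mul_apply, Equiv.Perm.mul_apply, Fin.revPerm_apply, Fin.revPerm_apply,
    Fin.rev_lt_rev, w0_lt_iff hpq]
  simp

end Longest

/-! ### Descent-preserving isomorphisms are right translations -/

section Translation

variable {n : ℕ}

/-- A covering step in the left weak order creates only one new left descent, namely the index of
the step. -/
theorem eq_of_mem_leftDescents_cover {γ : Equiv.Perm (Fin n)} {i j : Fin (n - 1)}
    (hi : i ∉ leftDescents γ) (hj : j ∈ leftDescents (simpleTransp i * γ))
    (hj' : j ∉ leftDescents γ) : j = i := by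
  by_contra hne
  rw [mem_leftDescents] at hi hj hj'
  change γ.symm ((simpleTransp i)⁻¹ _) < γ.symm ((simpleTransp i)⁻¹ _) at hj
  rw [simpleTransp_inv, simpleTransp_eq] at hj
  have hv : j.val ≠ i.val := fun h => hne (Fin.ext h)
  by_cases h1 : j.val = i.val + 1
  · have e1 : lowLetter j = highLetter i := Fin.ext h1
    rw [e1, Equiv.swap_apply_right, Equiv.swap_apply_of_ne_of_ne] at hj
    · rw [e1] at hj'
      exact hj' (hj.trans_le (not_lt.mp hi))
    all_goals simp only [ne_eq, Fin.ext_iff, lowLetter_val, highLetter_val]; omega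
  by_cases h2 : i.val = j.val + 1
  · have e1 : highLetter j = lowLetter i := Fin.ext h2.symm
    rw [e1, Equiv.swap_apply_left, Equiv.swap_apply_of_ne_of_ne] at hj
    · rw [e1] at hj'
      exact hj' ((not_lt.mp hi).trans_lt hj)
    all_goals simp only [ne_eq, Fin.ext_iff, lowLetter_val, highLetter_val]; omega
  · rw [Equiv.swap_apply_of_ne_of_ne, Equiv.swap_apply_of_ne_of_ne] at hj
    · exact hj' hj
    all_goals simp only [ne_eq, Fin.ext_iff, lowLetter_val, highLetter_val]; omega

theorem eq_or_eq_of_leftLE_cover {γ δ : Equiv.Perm (Fin n)} {i : Fin (n - 1)}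
    (hi : i ∉ leftDescents γ) (h1 : LeftLE γ δ) (h2 : LeftLE δ (simpleTransp i * γ)) :
    δ = γ ∨ δ = simpleTransp i * γ := by
  rw [leftLE_iff_inversions_subset] at h1 h2
  have hc : (inversions (simpleTransp i * γ)).card = (inversions γ).card + 1 := by
    rw [inversions_cover hi, Finset.card_insert_of_notMem letters_notMem_inversions]
  by_cases h : (inversions δ).card ≤ (inversions γ).card
  · exact Or.inl (eq_of_inversions_eq (Finset.eq_of_subset_of_card_le h1 h).symm)
  · exact Or.inr (eq_of_inversions_eq (Finset.eq_of_subset_of_card_le h2 (by omega)))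

/-- Since the left descents tell the index of each covering step, a descent-preserving isomorphism
commutes with all steps, so it is a right translation. -/
theorem exists_translation_of_descentIso {σ ρ σ' ρ' : Equiv.Perm (Fin n)} (h : LeftLE σ ρ)
    (f : leftInterval σ ρ ≃ leftInterval σ' ρ')
    (hle : ∀ γ δ, LeftLE (f γ : Equiv.Perm (Fin n)) (f δ) ↔ LeftLE (γ : Equiv.Perm (Fin n)) δ)
    (hdes : ∀ γ, leftDescents (f γ : Equiv.Perm (Fin n)) =
      leftDescents (γ : Equiv.Perm (Fin n))) :
    ∃ π : Equiv.Perm (Fin n), ∀ γ, (f γ : Equiv.Perm (Fin n)) = γ * π := by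
  refine ⟨σ⁻¹ * f ⟨σ, left_mem_leftInterval h⟩, ?_⟩
  rintro ⟨γ, h1, h2⟩
  dsimp only
  induction h1 with
  | refl => simp
  | @tail γ δ h1 hstep ih =>
    obtain ⟨i, hi, rfl⟩ := hstep
    have h3 : LeftLE γ ρ := (leftLE_simpleTransp_mul hi).trans h2
    specialize ih h3
    set x : leftInterval σ ρ := ⟨γ, h1, h3⟩ with hx
    set y : leftInterval σ ρ := ⟨simpleTransp i * γ, h1.trans (leftLE_simpleTransp_mul hi), h2⟩
      with hy
    have hxy : LeftLE (f x : Equiv.Perm (Fin n)) (f y) :=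
      (hle x y).mpr (leftLE_simpleTransp_mul hi)
    have hne : (f x : Equiv.Perm (Fin n)) ≠ f y := fun h => by
      have h4 : x = y := f.injective (Subtype.ext h)
      have h5 : γ = simpleTransp i * γ := congrArg Subtype.val h4
      have h6 := inversions_cover hi
      rw [← h5] at h6
      exact letters_notMem_inversions (h6 ▸ Finset.mem_insert_self _ _)
    obtain ⟨j, hj, hs⟩ :=
      exists_cover_of_inversions_subset (leftLE_iff_inversions_subset.mp hxy) hne
    rw [← leftLE_iff_inversions_subset] at hs
    have hz : simpleTransp j * (f x : Equiv.Perm (Fin n)) ∈ leftInterval σ' ρ' :=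
      ⟨(f x).2.1.trans (leftLE_simpleTransp_mul hj), hs.trans (f y).2.2⟩
    obtain ⟨z, hfz⟩ := f.surjective ⟨_, hz⟩
    have hfz' : (f z : Equiv.Perm (Fin n)) = simpleTransp j * f x := congrArg Subtype.val hfz
    have hyz : z = y := by
      rcases eq_or_eq_of_leftLE_cover hi
        ((hle x z).mp (hfz' ▸ leftLE_simpleTransp_mul hj)) ((hle z y).mp (hfz' ▸ hs)) with h | h
      · have h4 : z = x := Subtype.ext h
        rw [h4] at hfz'
        have h6 := inversions_cover hj
        rw [← hfz'] at h6
        exact absurd (h6 ▸ Finset.mem_insert_self _ _) letters_notMem_inversions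
      · exact Subtype.ext h
    rw [hyz] at hfz'
    have hji : j = i := by
      refine eq_of_mem_leftDescents_cover hi (j := j) ?_ ?_
      · have := hdes y
        rw [hfz'] at this
        rw [show simpleTransp i * γ = (y : Equiv.Perm (Fin n)) from rfl, ← this, mem_leftDescents]
        have h4 := lt_or_gt_letters (f x : Equiv.Perm (Fin n)) j
        rw [mem_leftDescents] at hj
        change (f x : Equiv.Perm (Fin n)).symm ((simpleTransp j)⁻¹ _) <
          (f x : Equiv.Perm (Fin n)).symm ((simpleTransp j)⁻¹ _)
        simpa using h4.resolve_right hj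
      · have := hdes x
        rw [this] at hj
        exact hj
    rw [hfz', hji, ih, mul_assoc]

end Translation

/-! ### Fillings of diagrams -/

section Fillings

variable {n : ℕ} {D : Finset (ℕ × ℕ)}

theorem fillingOf_le_iff {L : Type} [LinearOrder L] (key : ℕ × ℕ ↪ L) (hD : D.card = n)
    (b c : {b // b ∈ D}) :
    fillingOf key D hD b ≤ fillingOf key D hD c ↔ key b ≤ key c := by
  simp only [fillingOf, Equiv.trans_apply]
  exact ((D.map key).orderIsoOfFin (by rw [Finset.card_map, hD])).symm.le_iff_le

theorem colTableau_le_iff (hD : D.card = n) (b c : {b // b ∈ D}) :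
    colTableau D hD b ≤ colTableau D hD c ↔
      b.1.1 < c.1.1 ∨ b.1.1 = c.1.1 ∧ b.1.2 ≤ c.1.2 :=
  (fillingOf_le_iff _ _ _ _).trans Prod.Lex.toLex_le_toLex

theorem rowTableau_le_iff (hD : D.card = n) (b c : {b // b ∈ D}) :
    rowTableau D hD b ≤ rowTableau D hD c ↔
      b.1.2 < c.1.2 ∨ b.1.2 = c.1.2 ∧ b.1.1 ≤ c.1.1 :=
  (fillingOf_le_iff _ _ _ _).trans Prod.Lex.toLex_le_toLex

theorem fillDown_le_iff (hD : D.card = n) (b c : {b // b ∈ D}) :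
    fillDown D hD b ≤ fillDown D hD c ↔
      b.1.1 < c.1.1 ∨ b.1.1 = c.1.1 ∧ c.1.2 ≤ b.1.2 :=
  (fillingOf_le_iff _ _ _ _).trans Prod.Lex.toLex_le_toLex

theorem fillRight_le_iff (hD : D.card = n) (b c : {b // b ∈ D}) :
    fillRight D hD b ≤ fillRight D hD c ↔
      c.1.2 < b.1.2 ∨ b.1.2 = c.1.2 ∧ b.1.1 ≤ c.1.1 :=
  (fillingOf_le_iff _ _ _ _).trans (Prod.Lex.toLex_le_toLex.trans (by
    simp only [OrderDual.toDual_lt_toDual, OrderDual.toDual_inj]))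

theorem mem_linearExtensions_posetOf {F : Filling n D} {σ : Equiv.Perm (Fin n)} :
    σ ∈ linearExtensions (posetOf F) ↔
      ∀ b c : {b // b ∈ D}, (b : ℕ × ℕ) ≤ c → σ (F b) ≤ σ (F c) := by
  constructor
  · intro h b c hbc
    refine h (F b) (F c) ?_
    change (F.symm (F b) : ℕ × ℕ) ≤ F.symm (F c)
    simpa using hbc
  · intro h i j hij
    simpa using h (F.symm i) (F.symm j) hij

/-- An interval is the set of linear extensions of a poset of boxes as soon as the order of the
boxes is the intersection of the two linear orders given by the endpoints. -/
theorem leftInterval_eq_linearExtensions {σ ρ : Equiv.Perm (Fin n)} (h : LeftLE σ ρ)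
    (F : Filling n D) (hF : ∀ b c : {b // b ∈ D},
      (b : ℕ × ℕ) ≤ c ↔ σ (F b) ≤ σ (F c) ∧ ρ (F b) ≤ ρ (F c)) :
    leftInterval σ ρ = linearExtensions (posetOf F) := by
  ext γ
  rw [mem_leftInterval_iff h, mem_linearExtensions_posetOf]
  constructor
  · intro hγ b c hbc
    exact hγ _ _ ((hF b c).mp hbc).1 ((hF b c).mp hbc).2
  · intro hγ p q h1 h2
    simpa using hγ (F.symm p) (F.symm q) ((hF _ _).mpr (by simpa using ⟨h1, h2⟩))

/-- The entries of the filling increase weakly to the right and weakly downwards. These fillings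
are the reflections of the standard tableaux of the reflected diagram. -/
def SoutheastIncreasing (F : Filling n D) : Prop :=
  ∀ b c : {b // b ∈ D}, b.1.1 ≤ c.1.1 → c.1.2 ≤ b.1.2 → F b ≤ F c

theorem fillDown_southeastIncreasing (hD : D.card = n) : SoutheastIncreasing (fillDown D hD) :=
  fun b c h1 h2 => (fillDown_le_iff hD b c).mpr (by omega)

theorem fillRight_southeastIncreasing (hD : D.card = n) : SoutheastIncreasing (fillRight D hD) :=
  fun b c h1 h2 => (fillRight_le_iff hD b c).mpr (by omega)

theorem SoutheastIncreasing.lt {F : Filling n D} (hF : SoutheastIncreasing F)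
    {b c : {b // b ∈ D}} (h1 : b.1.1 ≤ c.1.1) (h2 : c.1.2 ≤ b.1.2) (hne : b ≠ c) : F b < F c :=
  lt_of_le_of_ne (hF b c h1 h2) fun h => hne (F.injective h)

/-- It suffices to compare boxes that span a rectangle without further boxes. -/
theorem southeastIncreasing_of_empty_rectangles {F : Filling n D}
    (h : ∀ b c : {b // b ∈ D}, b.1.1 ≤ c.1.1 → c.1.2 ≤ b.1.2 → b ≠ c →
      (∀ d : {b // b ∈ D}, b.1.1 ≤ d.1.1 → d.1.2 ≤ b.1.2 → d.1.1 ≤ c.1.1 → c.1.2 ≤ d.1.2 →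
        d = b ∨ d = c) → F b ≤ F c) :
    SoutheastIncreasing F := by
  intro b c h1 h2
  induction hk : (c.1.1 - b.1.1) + (b.1.2 - c.1.2) using Nat.strong_induction_on
    generalizing b c with
  | _ k ih =>
    by_cases hne : b = c
    · rw [hne]
    by_cases hd : ∀ d : {b // b ∈ D}, b.1.1 ≤ d.1.1 → d.1.2 ≤ b.1.2 → d.1.1 ≤ c.1.1 →
        c.1.2 ≤ d.1.2 → d = b ∨ d = c
    · exact h b c h1 h2 hne hd
    · push Not at hd
      obtain ⟨d, h3, h4, h5, h6, h7, h8⟩ := hd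
      have h9 : ¬(d.1.1 = b.1.1 ∧ d.1.2 = b.1.2) := fun h =>
        h7 (Subtype.ext (Prod.ext h.1 h.2))
      have h10 : ¬(d.1.1 = c.1.1 ∧ d.1.2 = c.1.2) := fun h =>
        h8 (Subtype.ext (Prod.ext h.1 h.2))
      exact (ih _ (by omega) b d h3 h4 rfl).trans (ih _ (by omega) d c h5 h6 rfl)

/-- The column tableau read in the order of `F`: for a southeast-increasing `F`, the bottom of the
interval of linear extensions of its poset. -/
noncomputable def bottomPerm (hD : D.card = n) (F : Filling n D) : Equiv.Perm (Fin n) :=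
  F.symm.trans (colTableau D hD)

/-- The row tableau read in the order of `F`: for a southeast-increasing `F`, the top of the
interval of linear extensions of its poset. -/
noncomputable def topPerm (hD : D.card = n) (F : Filling n D) : Equiv.Perm (Fin n) :=
  F.symm.trans (rowTableau D hD)

/-- Of two boxes that are incomparable in the poset, the upper left one comes first in the column
order and last in the row order, and it has the smaller entry in `F`. -/
theorem bottomPerm_leftLE_topPerm (hD : D.card = n) {F : Filling n D}
    (hF : SoutheastIncreasing F) : LeftLE (bottomPerm hD F) (topPerm hD F) := by
  rw [leftLE_iff]
  intro p q hpq
  obtain ⟨b, rfl⟩ := F.surjective p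
  obtain ⟨c, rfl⟩ := F.surjective q
  simp only [bottomPerm, topPerm, Equiv.trans_apply, Equiv.symm_apply_apply]
  rw [← not_le, ← not_le, colTableau_le_iff, rowTableau_le_iff]
  intro h1 h2
  exact hpq.not_ge (hF c b (by omega) (by omega))

theorem linearExtensions_eq_leftInterval (hD : D.card = n) {F : Filling n D}
    (hF : SoutheastIncreasing F) :
    linearExtensions (posetOf F) = leftInterval (bottomPerm hD F) (topPerm hD F) := by
  refine (leftInterval_eq_linearExtensions (bottomPerm_leftLE_topPerm hD hF) F
    fun b c => ?_).symm
  simp only [bottomPerm, topPerm, Equiv.trans_apply, Equiv.symm_apply_apply]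
  rw [colTableau_le_iff, rowTableau_le_iff, Prod.le_def]
  omega

/-! ### The labellings that give descent-isomorphic intervals -/

/-- In a diagram free of strictly upper-right pairs, two boxes with consecutive entries in a
standard tableau never lie strictly to the upper right of one another, since a box between them
would need an entry in between. So one of the two is weakly to the upper left of the other, and
every southeast-increasing labelling orders them in the same way. -/
theorem mem_leftDescents_iff (hfree : FreeOfStrictlyUpperRight D) {F : Filling n D}
    (hF : SoutheastIncreasing F) {σ : Equiv.Perm (Fin n)}
    (hσ : σ ∈ linearExtensions (posetOf F)) {i : Fin (n - 1)} {b c : {b // b ∈ D}}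
    (hb : σ (F b) = lowLetter i) (hc : σ (F c) = highLetter i) :
    i ∈ leftDescents σ ↔ c.1.1 ≤ b.1.1 ∧ b.1.2 ≤ c.1.2 := by
  rw [mem_linearExtensions_posetOf] at hσ
  have hne : b ≠ c := by
    rintro rfl
    exact (lowLetter_lt_highLetter i).ne (hb.symm.trans hc)
  rw [mem_leftDescents, ← hb, ← hc, Equiv.symm_apply_apply, Equiv.symm_apply_apply]
  refine ⟨fun h => ?_, fun h => hF.lt h.1 h.2 hne.symm⟩
  by_contra hcon
  have h1 : ¬(b.1.1 ≤ c.1.1 ∧ c.1.2 ≤ b.1.2) := fun h1 => h.not_ge (hF b c h1.1 h1.2)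
  have h2 : ¬((c : ℕ × ℕ) ≤ b) := fun h2 => by
    have := hσ c b h2
    rw [hb, hc] at this
    exact (lowLetter_lt_highLetter i).not_ge this
  rw [Prod.le_def] at h2
  refine hfree ⟨b, b.2, c, c.2, by omega, by omega, fun d hd hbd hdc => ?_⟩
  have h3 := hσ b ⟨d, hd⟩ hbd
  have h4 := hσ ⟨d, hd⟩ c hdc
  rw [hb, Fin.le_def, lowLetter_val] at h3
  rw [hc, Fin.le_def, highLetter_val] at h4
  rcases (show (σ (F ⟨d, hd⟩)).val = i.val ∨ (σ (F ⟨d, hd⟩)).val = i.val + 1 by omega) with h5 | h5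
  · exact Or.inl (congrArg Subtype.val
      (F.injective (σ.injective ((Fin.ext h5 : _ = lowLetter i).trans hb.symm))))
  · exact Or.inr (congrArg Subtype.val
      (F.injective (σ.injective ((Fin.ext h5 : _ = highLetter i).trans hc.symm))))

/-- Transport of linear extensions along a change of labelling. -/
def relabel (F G : Filling n D) :
    linearExtensions (posetOf F) ≃ linearExtensions (posetOf G) where
  toFun γ := ⟨G.symm.trans (F.trans γ), mem_linearExtensions_posetOf.mpr fun b c h => by
    simpa using mem_linearExtensions_posetOf.mp γ.2 b c h⟩
  invFun γ := ⟨F.symm.trans (G.trans γ), mem_linearExtensions_posetOf.mpr fun b c h => by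
    simpa using mem_linearExtensions_posetOf.mp γ.2 b c h⟩
  left_inv γ := by ext; simp
  right_inv γ := by ext; simp

/-- The left weak order on linear extensions depends on the incomparable pairs of boxes only. -/
theorem leftLE_iff_of_southeastIncreasing {F : Filling n D} (hF : SoutheastIncreasing F)
    {γ δ : Equiv.Perm (Fin n)} (hγ : γ ∈ linearExtensions (posetOf F))
    (hδ : δ ∈ linearExtensions (posetOf F)) :
    LeftLE γ δ ↔ ∀ b c : {b // b ∈ D}, b.1.1 < c.1.1 → c.1.2 < b.1.2 →
      γ (F c) < γ (F b) → δ (F c) < δ (F b) := by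
  rw [mem_linearExtensions_posetOf] at hγ hδ
  rw [leftLE_iff]
  constructor
  · intro h b c h1 h2 h3
    refine h _ _ (hF.lt h1.le h2.le ?_) h3
    rintro rfl
    exact h1.false
  · intro h p q hpq h1
    obtain ⟨b, rfl⟩ := F.surjective p
    obtain ⟨c, rfl⟩ := F.surjective q
    have h2 : ¬(b : ℕ × ℕ) ≤ c := fun h => h1.not_ge (hγ b c h)
    have h3 : ¬(c.1.1 ≤ b.1.1 ∧ b.1.2 ≤ c.1.2) := fun h => hpq.not_ge (hF c b h.1 h.2)
    rw [Prod.le_def] at h2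
    by_cases h4 : (c : ℕ × ℕ) ≤ b
    · exact perm_lt_of_le_of_ne (hδ c b h4) hpq.ne'
    · rw [Prod.le_def] at h4
      exact h b c (by omega) (by omega) h1

theorem descentIso_of_southeastIncreasing (hfree : FreeOfStrictlyUpperRight D)
    {F G : Filling n D} (hF : SoutheastIncreasing F) (hG : SoutheastIncreasing G) :
    DescentIso (linearExtensions (posetOf F)) (linearExtensions (posetOf G)) := by
  have hr : ∀ γ b, (relabel F G γ : Equiv.Perm (Fin n)) (G b) = (γ : Equiv.Perm (Fin n)) (F b) :=
    fun γ b => by simp [relabel]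
  refine ⟨relabel F G, fun γ δ => ?_, fun γ => ?_⟩
  · rw [leftLE_iff_of_southeastIncreasing hF γ.2 δ.2,
      leftLE_iff_of_southeastIncreasing hG (relabel F G γ).2 (relabel F G δ).2]
    simp only [hr]
  · ext i
    obtain ⟨b, hb⟩ := (F.trans (γ : Equiv.Perm (Fin n))).surjective (lowLetter i)
    obtain ⟨c, hc⟩ := (F.trans (γ : Equiv.Perm (Fin n))).surjective (highLetter i)
    rw [mem_leftDescents_iff hfree hF γ.2 hb hc,
      mem_leftDescents_iff hfree hG (relabel F G γ).2 ((hr γ b).trans hb) ((hr γ c).trans hc)]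

/-- Two boxes can be given consecutive entries in a standard tableau unless the order of the boxes
forbids it: fill what lies below one of them first, then these two boxes, then the rest. -/
theorem exists_consecutive_tableau (hD : D.card = n) {b c : {b // b ∈ D}} (hne : b ≠ c)
    (hcb : ¬ (c : ℕ × ℕ) ≤ b)
    (hbc : ∀ d : {b // b ∈ D}, (b : ℕ × ℕ) ≤ d → (d : ℕ × ℕ) ≤ c → d = b ∨ d = c) :
    ∃ (T : StandardTableau n D) (i : Fin (n - 1)),
      T.1 b = lowLetter i ∧ T.1 c = highLetter i := by
  classical
  let level : ℕ × ℕ → ℕ := fun x =>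
    if x = b then 1 else if x = c then 2 else if x ≤ b ∨ x ≤ c then 0 else 3
  let key : ℕ × ℕ ↪ ℕ ×ₗ (ℕ ×ₗ ℕ) :=
    ⟨fun x => toLex (level x, toLex x), fun x y h =>
      congrArg (fun p : ℕ ×ₗ (ℕ ×ₗ ℕ) => ofLex (ofLex p).2) h⟩
  have hkey : ∀ x y : {b // b ∈ D}, fillingOf key D hD x ≤ fillingOf key D hD y ↔
      level x < level y ∨ level x = level y ∧ toLex (x : ℕ × ℕ) ≤ toLex (y : ℕ × ℕ) := fun x y =>
    (fillingOf_le_iff _ _ _ _).trans Prod.Lex.toLex_le_toLex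
  have hlb : level b = 1 := if_pos rfl
  have hlc : level c = 2 := by
    have : (c : ℕ × ℕ) ≠ b := fun h => hne (Subtype.ext h.symm)
    simp [level, this]
  have hmono : ∀ x y : {b // b ∈ D}, (x : ℕ × ℕ) ≤ y → level x ≤ level y := by
    intro x y hxy
    by_cases hyb : y = b
    · rw [hyb] at hxy ⊢
      by_cases hxb : x = b
      · rw [hxb]
      · have h1 : (x : ℕ × ℕ) ≠ b := fun h => hxb (Subtype.ext h)
        have h2 : (x : ℕ × ℕ) ≠ c := fun h => hcb (h ▸ hxy)
        simp [level, h1, h2, hxy]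
    by_cases hyc : y = c
    · rw [hyc] at hxy ⊢
      rw [hlc]
      simp only [level]
      split_ifs with h1 h2 h3
      · exact one_le_two
      · exact le_rfl
      · exact zero_le
      · exact absurd (Or.inr hxy) h3
    have h1 : (y : ℕ × ℕ) ≠ b := fun h => hyb (Subtype.ext h)
    have h2 : (y : ℕ × ℕ) ≠ c := fun h => hyc (Subtype.ext h)
    by_cases hy : (y : ℕ × ℕ) ≤ b ∨ (y : ℕ × ℕ) ≤ c
    · have h3 : (x : ℕ × ℕ) ≠ b := by
        intro h
        rcases hy with hy | hy
        · exact h1 (le_antisymm hy (h ▸ hxy))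
        · rcases hbc y (h ▸ hxy) hy with h | h
          · exact hyb h
          · exact hyc h
      have h4 : (x : ℕ × ℕ) ≠ c := by
        intro h
        rcases hy with hy | hy
        · exact hcb ((h ▸ hxy).trans hy)
        · exact h2 (le_antisymm hy (h ▸ hxy))
      have h5 : (x : ℕ × ℕ) ≤ b ∨ (x : ℕ × ℕ) ≤ c := hy.imp hxy.trans hxy.trans
      have h6 : level x = 0 := by simp only [level, if_neg h3, if_neg h4, if_pos h5]
      rw [h6]
      exact zero_le
    · have h3 : level y = 3 := by simp only [level, if_neg h1, if_neg h2, if_neg hy]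
      rw [h3]
      simp only [level]
      split_ifs <;> omega
  have hlt : fillingOf key D hD b < fillingOf key D hD c := by
    rw [← not_le, hkey]
    omega
  have hval : (fillingOf key D hD c).val = (fillingOf key D hD b).val + 1 := by
    by_contra hcon
    rw [Fin.lt_def] at hlt
    have hc := (fillingOf key D hD c).isLt
    obtain ⟨d, hd⟩ := (fillingOf key D hD).surjective
      ⟨(fillingOf key D hD b).val + 1, by omega⟩
    have hbd : ¬ fillingOf key D hD d ≤ fillingOf key D hD b := by
      rw [hd, Fin.le_def]
      simp
    have hdc : ¬ fillingOf key D hD c ≤ fillingOf key D hD d := by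
      rw [hd, Fin.le_def]
      dsimp only
      omega
    have hb' : (d : ℕ × ℕ) ≠ b := fun h => hbd (by rw [Subtype.ext h])
    have hc' : (d : ℕ × ℕ) ≠ c := fun h => hdc (by rw [Subtype.ext h])
    rw [hkey] at hbd hdc
    have : level d = 0 ∨ level d = 3 := by
      simp only [level, if_neg hb', if_neg hc']
      split_ifs <;> simp
    omega
  refine ⟨⟨fillingOf key D hD, fun x y hxy => (hkey x y).mpr ?_⟩,
    ⟨(fillingOf key D hD b).val, ?_⟩, rfl, Fin.ext hval⟩
  · rcases (hmono x y hxy).lt_or_eq with h | h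
    · exact Or.inl h
    · exact Or.inr ⟨h, Prod.Lex.toLex_mono hxy⟩
  · have := (fillingOf key D hD c).isLt
    omega

/-- Every interval in the class of a southeast-increasing labelling comes from such a labelling:
the descents of the tableaux with consecutive entries in two given boxes recover the order of the
labels of these boxes. -/
theorem exists_southeastIncreasing_of_descentIso (hD : D.card = n) {F : Filling n D}
    (hF : SoutheastIncreasing F) {J : Set (Equiv.Perm (Fin n))} (hJ : J ∈ leftIntervals n)
    (hiso : DescentIso (linearExtensions (posetOf F)) J) :
    ∃ G : Filling n D, SoutheastIncreasing G ∧ J = linearExtensions (posetOf G) := by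
  obtain ⟨σ', ρ', -, rfl⟩ := hJ
  rw [linearExtensions_eq_leftInterval hD hF] at hiso
  obtain ⟨f, hle, hdes⟩ := hiso
  obtain ⟨π, hπ⟩ :=
    exists_translation_of_descentIso (bottomPerm_leftLE_topPerm hD hF) f hle hdes
  have hmem : ∀ γ, γ ∈ leftInterval (bottomPerm hD F) (topPerm hD F) ↔
      ∀ b c : {b // b ∈ D}, (b : ℕ × ℕ) ≤ c → γ (F b) ≤ γ (F c) := fun γ => by
    rw [← linearExtensions_eq_leftInterval hD hF, mem_linearExtensions_posetOf]
  let G : Filling n D := F.trans π.symm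
  have hG : ∀ b, π (G b) = F b := fun b => by simp [G]
  refine ⟨G, southeastIncreasing_of_empty_rectangles fun b c h1 h2 hne hd => ?_, ?_⟩
  · have hdesc : ∀ (T : StandardTableau n D) (i : Fin (n - 1)) (x y : {b // b ∈ D}),
        T.1 x = lowLetter i → T.1 y = highLetter i → (G y < G x ↔ F y < F x) := by
      intro T i x y hx hy
      have h3 : F.symm.trans T.1 ∈ leftInterval (bottomPerm hD F) (topPerm hD F) :=
        (hmem _).mpr fun b c h => by simpa using T.2 b c h
      have h4 := hdes ⟨_, h3⟩
      rw [hπ] at h4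
      have h5 := Finset.ext_iff.mp h4 i
      rw [mem_leftDescents, mem_leftDescents] at h5
      have h6 : ∀ z, Equiv.symm ((F.symm.trans T.1 : Equiv.Perm (Fin n)) * π) (T.1 z) = G z :=
        fun z => by
          rw [Equiv.symm_apply_eq]
          simp [hG]
      rw [← hx, ← hy, h6, h6] at h5
      simpa using h5
    have hFlt := hF.lt h1 h2 hne
    by_cases hcb : (c : ℕ × ℕ) ≤ b
    · have hbc : ¬ (b : ℕ × ℕ) ≤ c := fun h => hne (Subtype.ext (le_antisymm h hcb))
      obtain ⟨T, i, hc, hb⟩ := exists_consecutive_tableau hD hne.symm hbc fun d hcd hdb => by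
        rw [Prod.le_def] at hcb hcd hdb
        exact (hd d (by omega) (by omega) (by omega) (by omega)).symm
      exact ((hdesc T i c b hc hb).mpr hFlt).le
    · obtain ⟨T, i, hb, hc⟩ := exists_consecutive_tableau hD hne hcb fun d hbd hdc => by
        rw [Prod.le_def] at hcb hbd hdc
        exact hd d (by omega) (by omega) (by omega) (by omega)
      exact not_lt.mp fun h => hFlt.asymm ((hdesc T i b c hb hc).mp h)
  · ext δ
    rw [mem_linearExtensions_posetOf]
    constructor
    · intro h b c hbc
      obtain ⟨γ, hγ⟩ := f.surjective ⟨δ, h⟩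
      have h1 := hπ γ
      rw [hγ] at h1
      dsimp only at h1
      rw [h1, Equiv.Perm.mul_apply, Equiv.Perm.mul_apply, hG, hG]
      exact (hmem _).mp γ.2 b c hbc
    · intro h
      have h1 : δ * π⁻¹ ∈ leftInterval (bottomPerm hD F) (topPerm hD F) := (hmem _).mpr h
      have h2 := (f ⟨_, h1⟩).2
      rw [hπ] at h2
      simpa using h2

end Fillings

/-! ### The class and the standard tableaux of the reflected diagram -/

section Classes

variable {n : ℕ} {D : Finset (ℕ × ℕ)}

theorem IsDiagram.row_le (hD : IsDiagram n D) (b : {b // b ∈ D}) :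
    1 ≤ b.1.2 ∧ b.1.2 ≤ numRows D :=
  Finset.mem_Icc.mp (hD.rows_eq ▸ Finset.mem_image_of_mem Prod.snd b.2)

theorem flipEquiv_fst (hD : IsDiagram n D) (b : {b // b ∈ D}) :
    (flipEquiv hD b).1.1 = b.1.1 := rfl

theorem flipEquiv_snd (hD : IsDiagram n D) (b : {b // b ∈ D}) :
    (flipEquiv hD b).1.2 = numRows D + 1 - b.1.2 := rfl

theorem flipEquiv_le_iff (hD : IsDiagram n D) (b c : {b // b ∈ D}) :
    (flipEquiv hD b : ℕ × ℕ) ≤ flipEquiv hD c ↔ b.1.1 ≤ c.1.1 ∧ c.1.2 ≤ b.1.2 := by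
  have h1 := hD.row_le b
  have h2 := hD.row_le c
  rw [Prod.le_def, flipEquiv_fst, flipEquiv_fst, flipEquiv_snd, flipEquiv_snd]
  omega

theorem reflectFilling_southeastIncreasing (hD : IsDiagram n D)
    (T : StandardTableau n (reflectX D)) : SoutheastIncreasing (reflectFilling hD T.1) :=
  fun b c h1 h2 => T.2 _ _ ((flipEquiv_le_iff hD b c).mpr ⟨h1, h2⟩)

theorem exists_reflectFilling_eq (hD : IsDiagram n D) {F : Filling n D}
    (hF : SoutheastIncreasing F) :
    ∃ T : StandardTableau n (reflectX D), reflectFilling hD T.1 = F := by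
  refine ⟨⟨(flipEquiv hD).symm.trans F, fun b c hbc => ?_⟩, ?_⟩
  · obtain ⟨b, rfl⟩ := (flipEquiv hD).surjective b
    obtain ⟨c, rfl⟩ := (flipEquiv hD).surjective c
    have := (flipEquiv_le_iff hD b c).mp hbc
    simpa using hF b c this.1 this.2
  · ext b
    simp [reflectFilling]

theorem mem_tableauIntervals (hD : IsDiagram n D) {J : Set (Equiv.Perm (Fin n))} :
    J ∈ tableauIntervals hD ↔
      ∃ G : Filling n D, SoutheastIncreasing G ∧ J = linearExtensions (posetOf G) := by
  constructor
  · rintro ⟨T, rfl⟩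
    exact ⟨_, reflectFilling_southeastIncreasing hD T, rfl⟩
  · rintro ⟨G, hG, rfl⟩
    obtain ⟨T, hT⟩ := exists_reflectFilling_eq hD hG
    exact ⟨T, by dsimp only; rw [hT]⟩

theorem descentClass_eq_tableauIntervals (hD : IsDiagram n D)
    (hfree : FreeOfStrictlyUpperRight D) {F : Filling n D} (hF : SoutheastIncreasing F) :
    descentClass (linearExtensions (posetOf F)) = tableauIntervals hD := by
  ext J
  rw [mem_tableauIntervals]
  constructor
  · rintro ⟨hJ, hiso⟩
    exact exists_southeastIncreasing_of_descentIso hD.card_eq hF hJ hiso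
  · rintro ⟨G, hG, rfl⟩
    exact ⟨⟨_, _, bottomPerm_leftLE_topPerm hD.card_eq hG,
      linearExtensions_eq_leftInterval hD.card_eq hG⟩,
      descentIso_of_southeastIncreasing hfree hF hG⟩

theorem intervalLE_iff_rightLE_bottomPerm (hD : D.card = n) {F G : Filling n D}
    (hF : SoutheastIncreasing F) (hG : SoutheastIncreasing G) :
    IntervalLE (linearExtensions (posetOf F)) (linearExtensions (posetOf G)) ↔
      RightLE (bottomPerm hD F) (bottomPerm hD G) := by
  rw [linearExtensions_eq_leftInterval hD hF, linearExtensions_eq_leftInterval hD hG,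
    intervalLE_iff (bottomPerm_leftLE_topPerm hD hF) (bottomPerm_leftLE_topPerm hD hG)]

/-- Reading the columns of the reflected diagram downwards is reading the columns of the diagram
upwards. -/
theorem bottomPerm_reflectFilling_inv (hD : IsDiagram n D) (T : Filling n (reflectX D)) :
    (bottomPerm hD.card_eq (reflectFilling hD T))⁻¹ = readTBLR hD.card_reflectX T := by
  have h : colTableau D hD.card_eq =
      (flipEquiv hD).trans (fillDown (reflectX D) hD.card_reflectX) := by
    refine equiv_eq_of_le_iff _ _ fun b c => ?_
    have h1 := hD.row_le b
    have h2 := hD.row_le c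
    rw [Equiv.trans_apply, Equiv.trans_apply, colTableau_le_iff, fillDown_le_iff, flipEquiv_fst,
      flipEquiv_fst, flipEquiv_snd, flipEquiv_snd]
    omega
  change (colTableau D hD.card_eq).symm.trans ((flipEquiv hD).trans T) =
    (fillDown (reflectX D) hD.card_reflectX).symm.trans T
  rw [h]
  ext x
  simp

theorem isoToTableaux_tableauIntervals (hD : IsDiagram n D) :
    IsoToTableaux hD (tableauIntervals hD) := by
  have hSE := reflectFilling_southeastIncreasing hD
  let f : StandardTableau n (reflectX D) → tableauIntervals hD := fun T =>
    ⟨linearExtensions (posetOf (reflectFilling hD T.1)), Set.mem_range_self T⟩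
  have hinj : Function.Injective f := by
    intro T U h
    have h1 : linearExtensions (posetOf (reflectFilling hD T.1)) =
        linearExtensions (posetOf (reflectFilling hD U.1)) := congrArg Subtype.val h
    rw [linearExtensions_eq_leftInterval hD.card_eq (hSE T),
      linearExtensions_eq_leftInterval hD.card_eq (hSE U)] at h1
    have h2 := bottom_unique (bottomPerm_leftLE_topPerm hD.card_eq (hSE T))
      (bottomPerm_leftLE_topPerm hD.card_eq (hSE U)) h1
    have h3 : readTBLR hD.card_reflectX T.1 = readTBLR hD.card_reflectX U.1 := by
      rw [← bottomPerm_reflectFilling_inv hD, ← bottomPerm_reflectFilling_inv hD, h2]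
    refine Subtype.ext (Equiv.ext fun b => ?_)
    have h4 := Equiv.congr_fun h3 (fillingOf keyTBLR _ hD.card_reflectX b)
    simpa [readTBLR] using h4
  have hsurj : Function.Surjective f := by
    rintro ⟨_, T, rfl⟩
    exact ⟨T, rfl⟩
  refine ⟨RelIso.symm ⟨Equiv.ofBijective f ⟨hinj, hsurj⟩, fun {T U} => ?_⟩⟩
  change IntervalLE (linearExtensions (posetOf (reflectFilling hD T.1)))
    (linearExtensions (posetOf (reflectFilling hD U.1))) ↔ TableauLE hD.card_reflectX T U
  rw [intervalLE_iff_rightLE_bottomPerm hD.card_eq (hSE T) (hSE U), rightLE_iff,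
    bottomPerm_reflectFilling_inv, bottomPerm_reflectFilling_inv, TableauLE]

/-- The right weak order on bottoms compares the labels of the boxes along the column tableau. -/
theorem rightLE_bottomPerm_iff (hD : D.card = n) (F G : Filling n D) :
    RightLE (bottomPerm hD F) (bottomPerm hD G) ↔
      ∀ b c : {b // b ∈ D}, colTableau D hD b < colTableau D hD c → F c < F b → G c < G b := by
  rw [rightLE_iff, leftLE_iff]
  constructor
  · intro h b c hbc
    simpa [bottomPerm] using h _ _ hbc
  · intro h p q hpq
    exact h _ _ (by simpa using hpq)

/-- `fillRight` inverts a pair of boxes in the column order whenever a southeast-increasing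
labelling can. -/
theorem isMaxOf_fillRight (hD : IsDiagram n D) :
    IsMaxOf (tableauIntervals hD) (linearExtensions (posetOf (fillRight D hD.card_eq))) := by
  have hR := fillRight_southeastIncreasing hD.card_eq
  refine ⟨(mem_tableauIntervals hD).mpr ⟨_, hR, rfl⟩, fun J hJ => ?_⟩
  obtain ⟨G, hG, rfl⟩ := (mem_tableauIntervals hD).mp hJ
  rw [intervalLE_iff_rightLE_bottomPerm hD.card_eq hG hR, rightLE_bottomPerm_iff]
  intro b c hbc h
  have h1 : ¬(b.1.1 ≤ c.1.1 ∧ c.1.2 ≤ b.1.2) := fun h1 => h.not_ge (hG b c h1.1 h1.2)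
  rw [← not_le, colTableau_le_iff] at hbc
  rw [← not_le, fillRight_le_iff]
  omega

/-- `fillDown` inverts a pair of boxes in the column order only if both lie in the same column,
where every southeast-increasing labelling must invert them. -/
theorem isMinOf_fillDown (hD : IsDiagram n D) :
    IsMinOf (tableauIntervals hD) (linearExtensions (posetOf (fillDown D hD.card_eq))) := by
  have hd := fillDown_southeastIncreasing hD.card_eq
  refine ⟨(mem_tableauIntervals hD).mpr ⟨_, hd, rfl⟩, fun J hJ => ?_⟩
  obtain ⟨G, hG, rfl⟩ := (mem_tableauIntervals hD).mp hJ
  rw [intervalLE_iff_rightLE_bottomPerm hD.card_eq hd hG, rightLE_bottomPerm_iff]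
  intro b c hbc h
  rw [← not_le, colTableau_le_iff] at hbc
  rw [← not_le, fillDown_le_iff] at h
  refine hG.lt (by omega) (by omega) ?_
  rintro rfl
  omega

end Classes

/-! ### Endpoints as longest elements -/

section Endpoints

variable {n : ℕ} {D : Finset (ℕ × ℕ)}

/-- If the boxes with property `p` have the smallest entries, then these are the entries below
their number. -/
theorem filling_lt_card_iff (F : Filling n D) (p : ℕ × ℕ → Prop) [DecidablePred p]
    (hp : ∀ b c : {b // b ∈ D}, p c → F b ≤ F c → p b) (b : {b // b ∈ D}) :
    (F b).val < (D.filter p).card ↔ p b := by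
  have hcard : (Finset.univ.filter fun i : Fin n => p (F.symm i)).card = (D.filter p).card := by
    refine Finset.card_bij (fun i _ => (F.symm i : ℕ × ℕ)) ?_ ?_ ?_
    · intro i hi
      exact Finset.mem_filter.mpr ⟨(F.symm i).2, (Finset.mem_filter.mp hi).2⟩
    · intro i _ j _ h
      exact F.symm.injective (Subtype.ext h)
    · intro x hx
      rw [Finset.mem_filter] at hx
      exact ⟨F ⟨x, hx.1⟩, by simpa using hx.2, by simp⟩
  rw [← hcard]
  constructor
  · intro h
    by_contra hb
    refine h.not_ge ?_
    rw [← Fin.card_Iio]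
    refine Finset.card_le_card fun i hi => Finset.mem_Iio.mpr (not_le.mp fun h1 => hb ?_)
    exact hp b (F.symm i) (Finset.mem_filter.mp hi).2 (by simpa using h1)
  · intro hb
    rw [← Nat.succ_le_iff, ← Nat.add_one, ← Fin.card_Iic]
    refine Finset.card_le_card fun i hi => Finset.mem_filter.mpr ⟨Finset.mem_univ _, ?_⟩
    exact hp (F.symm i) b hb (by simpa using hi)

theorem IsDiagram.col_le (hD : IsDiagram n D) (b : {b // b ∈ D}) :
    1 ≤ b.1.1 ∧ b.1.1 ≤ numCols D :=
  Finset.mem_Icc.mp (hD.cols_eq ▸ Finset.mem_image_of_mem Prod.fst b.2)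

theorem sum_take_colLengths (hD : IsDiagram n D) {k : ℕ} (hk : k ≤ numCols D) :
    ((colLengths D).take k).sum = (D.filter fun b => b.1 ≤ k).card := by
  rw [colLengths, ← List.map_take, List.take_range, min_eq_left hk]
  clear hk
  induction k with
  | zero =>
    symm
    simp only [List.range_zero, List.map_nil, List.sum_nil, Finset.card_eq_zero]
    refine Finset.filter_eq_empty_iff.mpr fun b hb h => ?_
    have := hD.col_le ⟨b, hb⟩
    dsimp only at this
    omega
  | succ k ih =>
    rw [List.range_succ, List.map_append, List.sum_append, ih]
    simp only [List.map_cons, List.map_nil, List.sum_cons, List.sum_nil, add_zero]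
    rw [← Finset.card_union_of_disjoint]
    · congr 1
      ext b
      simp only [Finset.mem_union, Finset.mem_filter, ← and_or_left]
      refine and_congr_right fun _ => ?_
      omega
    · refine Finset.disjoint_filter.mpr fun b _ h1 h2 => ?_
      omega

theorem sum_take_rowLengths (hD : IsDiagram n D) {k : ℕ} (hk : k ≤ numRows D) :
    ((rowLengths D).take k).sum = (D.filter fun b => numRows D - k < b.2).card := by
  rw [rowLengths, ← List.map_take, List.take_range, min_eq_left hk]
  induction k with
  | zero =>
    symm
    simp only [List.range_zero, List.map_nil, List.sum_nil, Finset.card_eq_zero]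
    refine Finset.filter_eq_empty_iff.mpr fun b hb h => ?_
    have := hD.row_le ⟨b, hb⟩
    dsimp only at this
    omega
  | succ k ih =>
    rw [List.range_succ, List.map_append, List.sum_append, ih (by omega)]
    simp only [List.map_cons, List.map_nil, List.sum_cons, List.sum_nil, add_zero]
    rw [← Finset.card_union_of_disjoint]
    · congr 1
      ext b
      simp only [Finset.mem_union, Finset.mem_filter, ← and_or_left]
      refine and_congr_right fun _ => ?_
      omega
    · refine Finset.disjoint_filter.mpr fun b _ h1 h2 => ?_
      omega

theorem mem_compSet {α : List ℕ} {i : Fin (n - 1)} :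
    i ∈ compSet n α ↔ ∃ k, 1 ≤ k ∧ k < α.length ∧ (α.take k).sum = i.val + 1 := by
  simp [compSet, and_assoc]

/-- Entries of `fillDown` are separated by an element of `compSet` if and only if their boxes lie
in different columns. -/
theorem exists_mem_compSet_colLengths_iff (hD : IsDiagram n D) (b c : {b // b ∈ D}) :
    (∃ z, z ∈ compSet n (colLengths D) ∧ (fillDown D hD.card_eq b).val ≤ z.val ∧
      z.val < (fillDown D hD.card_eq c).val) ↔ b.1.1 < c.1.1 := by
  have key : ∀ k (x : {b // b ∈ D}), (fillDown D hD.card_eq x).val <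
      (D.filter fun b => b.1 ≤ k).card ↔ x.1.1 ≤ k := fun k x =>
    filling_lt_card_iff _ (fun b => b.1 ≤ k) (fun x y hy hxy => by
      rw [fillDown_le_iff] at hxy
      omega) x
  have hlen : (colLengths D).length = numCols D := by simp [colLengths]
  constructor
  · rintro ⟨z, hz, h1, h2⟩
    obtain ⟨k, -, hk, hs⟩ := mem_compSet.mp hz
    rw [sum_take_colLengths hD (by omega)] at hs
    have hb := key k b
    have hc := key k c
    omega
  · intro h
    have hb := key b.1.1 b
    have hc := key b.1.1 c
    have h1 := hD.col_le b
    have h2 := hD.col_le c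
    have h3 := (fillDown D hD.card_eq c).isLt
    refine ⟨⟨(D.filter fun x => x.1 ≤ b.1.1).card - 1, by omega⟩,
      mem_compSet.mpr ⟨b.1.1, h1.1, by omega, ?_⟩, by dsimp only; omega, by dsimp only; omega⟩
    rw [sum_take_colLengths hD h1.2]
    dsimp only
    omega

/-- Entries of `fillRight` are separated by an element of `compSet` if and only if their boxes lie
in different rows. -/
theorem exists_mem_compSet_rowLengths_iff (hD : IsDiagram n D) (b c : {b // b ∈ D}) :
    (∃ z, z ∈ compSet n (rowLengths D) ∧ (fillRight D hD.card_eq b).val ≤ z.val ∧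
      z.val < (fillRight D hD.card_eq c).val) ↔ c.1.2 < b.1.2 := by
  have key : ∀ k (x : {b // b ∈ D}), (fillRight D hD.card_eq x).val <
      (D.filter fun b => numRows D - k < b.2).card ↔ numRows D - k < x.1.2 := fun k x =>
    filling_lt_card_iff _ (fun b => numRows D - k < b.2) (fun x y hy hxy => by
      rw [fillRight_le_iff] at hxy
      omega) x
  have hlen : (rowLengths D).length = numRows D := by simp [rowLengths]
  constructor
  · rintro ⟨z, hz, h1, h2⟩
    obtain ⟨k, -, hk, hs⟩ := mem_compSet.mp hz
    rw [sum_take_rowLengths hD (by omega)] at hs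
    have hb := key k b
    have hc := key k c
    omega
  · intro h
    have h1 := hD.row_le b
    have h2 := hD.row_le c
    obtain ⟨k, hk⟩ : ∃ k, k = numRows D + 1 - b.1.2 := ⟨_, rfl⟩
    have hb := key k b
    have hc := key k c
    have h3 := (fillRight D hD.card_eq c).isLt
    refine ⟨⟨(D.filter fun x => numRows D - k < x.2).card - 1, by omega⟩,
      mem_compSet.mpr ⟨k, by omega, by omega, ?_⟩, by dsimp only; omega, by dsimp only; omega⟩
    rw [sum_take_rowLengths hD (by omega)]
    dsimp only
    omega

theorem bottomPerm_fillDown (hD : IsDiagram n D) :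
    bottomPerm hD.card_eq (fillDown D hD.card_eq) = w0 (compSet n (colLengths D))ᶜ := by
  refine eq_of_inversions_eq ?_
  ext ⟨p, q⟩
  rw [mem_inversions, mem_inversions]
  refine and_congr_right fun hpq => ?_
  dsimp only at hpq ⊢
  have h1 := w0_lt_iff (S := (compSet n (colLengths D))ᶜ) hpq
  have hne : w0 (compSet n (colLengths D))ᶜ p ≠ w0 (compSet n (colLengths D))ᶜ q :=
    fun h => hpq.ne (Equiv.injective _ h)
  rw [← not_le, ← not_le, hne.le_iff_lt, h1, not_iff_not]
  obtain ⟨b, rfl⟩ := (fillDown D hD.card_eq).surjective p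
  obtain ⟨c, rfl⟩ := (fillDown D hD.card_eq).surjective q
  simp only [Finset.mem_compl, not_not]
  rw [exists_mem_compSet_colLengths_iff hD]
  simp only [bottomPerm, Equiv.trans_apply, Equiv.symm_apply_apply]
  rw [colTableau_le_iff]
  rw [← not_le, fillDown_le_iff] at hpq
  omega

theorem topPerm_fillRight (hD : IsDiagram n D) :
    topPerm hD.card_eq (fillRight D hD.card_eq) = w1 (compSet n (rowLengths D)) := by
  refine eq_of_inversions_eq ?_
  ext ⟨p, q⟩
  rw [mem_inversions, mem_inversions]
  refine and_congr_right fun hpq => ?_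
  dsimp only at hpq ⊢
  rw [w1_lt_iff hpq]
  obtain ⟨b, rfl⟩ := (fillRight D hD.card_eq).surjective p
  obtain ⟨c, rfl⟩ := (fillRight D hD.card_eq).surjective q
  rw [exists_mem_compSet_rowLengths_iff hD]
  simp only [topPerm, Equiv.trans_apply, Equiv.symm_apply_apply]
  rw [← not_le, rowTableau_le_iff]
  rw [← not_le, fillRight_le_iff] at hpq
  omega

end Endpoints

/-! ### The diagrams of lower and upper descent intervals -/

section DescentIntervals

variable {n : ℕ}

theorem blockIndex_lt_iff {A : Finset (Fin (n - 1))} {p q : Fin n} :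
    blockIndex A p < blockIndex A q ↔ ∃ z ∈ A, p.val ≤ z.val ∧ z.val < q.val := by
  simp only [blockIndex, add_lt_add_iff_left]
  constructor
  · intro h
    by_contra! hc
    refine h.not_ge (Finset.card_le_card fun z hz => ?_)
    rw [Finset.mem_filter] at hz ⊢
    exact ⟨hz.1, not_le.mp fun h1 => (hc z hz.1 h1).not_gt hz.2⟩
  · rintro ⟨z, hz, h1, h2⟩
    refine Finset.card_lt_card (Finset.ssubset_iff_of_subset ?_ |>.mpr ⟨z, ?_, ?_⟩)
    · intro y hy
      rw [Finset.mem_filter] at hy ⊢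
      exact ⟨hy.1, by omega⟩
    · exact Finset.mem_filter.mpr ⟨hz, h2⟩
    · simp [h1]

theorem blockIndex_mono (A : Finset (Fin (n - 1))) {p q : Fin n} (h : p ≤ q) :
    blockIndex A p ≤ blockIndex A q := by
  by_contra! hc
  obtain ⟨z, -, h1, h2⟩ := blockIndex_lt_iff.mp hc
  rw [Fin.le_def] at h
  omega

theorem image_blockIndex (hn : 0 < n) (A : Finset (Fin (n - 1))) :
    Finset.univ.image (blockIndex A) = Finset.Icc 1 (A.card + 1) := by
  -- The block index starts at one and grows by at most one from each letter to the next.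
  have key : ∀ k (hk : k < n) j, 1 ≤ j → j ≤ blockIndex A ⟨k, hk⟩ → ∃ p, blockIndex A p = j := by
    intro k
    induction k with
    | zero =>
      intro hk j h1 h2
      refine ⟨⟨0, hk⟩, le_antisymm ?_ h2⟩
      simpa [blockIndex] using h1
    | succ k ih =>
      intro hk j h1 h2
      by_cases h : j ≤ blockIndex A ⟨k, by omega⟩
      · exact ih _ j h1 h
      · refine ⟨_, le_antisymm ?_ h2⟩
        have hsub : (A.filter fun z => z.val < k + 1) ⊆
            insert ⟨k, by omega⟩ (A.filter fun z => z.val < k) := by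
          intro z hz
          rw [Finset.mem_filter] at hz
          rw [Finset.mem_insert, Finset.mem_filter]
          rcases Nat.lt_succ_iff_lt_or_eq.mp hz.2 with h | h
          · exact Or.inr ⟨hz.1, h⟩
          · exact Or.inl (Fin.ext h)
        have h3 := (Finset.card_le_card hsub).trans (Finset.card_insert_le _ _)
        simp only [blockIndex] at h ⊢
        omega
  ext j
  simp only [Finset.mem_image, Finset.mem_univ, true_and, Finset.mem_Icc]
  constructor
  · rintro ⟨p, rfl⟩
    have := Finset.card_filter_le A fun z => z.val < p.val
    simp only [blockIndex]
    omega
  · rintro ⟨h1, h2⟩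
    refine key (n - 1) (by omega) j h1 ?_
    have : (A.filter fun z => z.val < n - 1) = A := Finset.filter_true_of_mem fun z _ => z.isLt
    simp only [blockIndex, this]
    omega

/-- The filling of the image of `g` that puts the entry `p` into the box `g p`. -/
noncomputable def fillingOfBoxes (g : Fin n → ℕ × ℕ) (hg : Function.Injective g) :
    Filling n (Finset.univ.image g) :=
  (Equiv.ofBijective
    (fun p => (⟨g p, Finset.mem_image_of_mem g (Finset.mem_univ p)⟩ :
      {b // b ∈ Finset.univ.image g}))
    ⟨fun _ _ h => hg (congrArg Subtype.val h), fun b => by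
      obtain ⟨p, -, h⟩ := Finset.mem_image.mp b.2
      exact ⟨p, Subtype.ext h⟩⟩).symm

theorem fillingOfBoxes_symm (g : Fin n → ℕ × ℕ) (hg : Function.Injective g) (p : Fin n) :
    ((fillingOfBoxes g hg).symm p : ℕ × ℕ) = g p := rfl

theorem card_image_boxes {g : Fin n → ℕ × ℕ} (hg : Function.Injective g) :
    (Finset.univ.image g).card = n := by
  rw [Finset.card_image_of_injective _ hg, Finset.card_univ, Fintype.card_fin]

theorem isDiagram_image {g : Fin n → ℕ × ℕ} (hg : Function.Injective g) {c r : ℕ}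
    (hc : Finset.univ.image (fun p => (g p).1) = Finset.Icc 1 c)
    (hr : Finset.univ.image (fun p => (g p).2) = Finset.Icc 1 r) :
    IsDiagram n (Finset.univ.image g) := by
  have hc' : (Finset.univ.image g).image Prod.fst = Finset.Icc 1 c := by
    rw [Finset.image_image]
    exact hc
  have hr' : (Finset.univ.image g).image Prod.snd = Finset.Icc 1 r := by
    rw [Finset.image_image]
    exact hr
  exact ⟨card_image_boxes hg, by rw [numCols, hc']; simp, by rw [numRows, hr']; simp⟩

/-- An interval is the set of linear extensions of a poset of boxes, given the boxes `g p` of the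
positions `p`. -/
theorem leftInterval_eq_of_boxes {g : Fin n → ℕ × ℕ} (hg : Function.Injective g)
    {σ ρ : Equiv.Perm (Fin n)} (h : LeftLE σ ρ)
    (hle : ∀ p q, g p ≤ g q ↔ σ p ≤ σ q ∧ ρ p ≤ ρ q) :
    leftInterval σ ρ = linearExtensions (posetOf (fillingOfBoxes g hg)) :=
  leftInterval_eq_linearExtensions h _ fun b c => by
    rw [← hle, ← fillingOfBoxes_symm g hg, ← fillingOfBoxes_symm g hg, Equiv.symm_apply_apply,
      Equiv.symm_apply_apply]

theorem image_comp_perm (f : Fin n → ℕ) (σ : Equiv.Perm (Fin n)) :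
    Finset.univ.image (fun p => f (σ p)) = Finset.univ.image f := by
  ext j
  simp only [Finset.mem_image, Finset.mem_univ, true_and]
  exact σ.surjective.exists (p := fun p => f p = j) |>.symm

/-- For a lower descent interval the boxes of the positions increase as in `fillDown`: letters in
the same block of positions are decreasing, and letters in the same block of values have increasing
positions. -/
theorem lower_descent_interval (hn : 0 < n) {S : Finset (Fin (n - 1))} {ρ : Equiv.Perm (Fin n)}
    (h : LeftLE (w0 S) ρ) :
    ∃ hD : IsDiagram n (lowerDiagram S ρ), leftInterval (w0 S) ρ =
      linearExtensions (posetOf (fillDown (lowerDiagram S ρ) hD.card_eq)) := by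
  let x : Fin n → ℕ := blockIndex Sᶜ
  let y : Fin n → ℕ := fun k => blockIndex (leftDescents ρ) (ρ k)
  let g : Fin n → ℕ × ℕ := fun k => (x k, y k)
  have key : ∀ p q : Fin n, p < q → x p ≤ x q ∧ (w0 S p < w0 S q ↔ x p < x q) ∧
      w0 S p ≠ w0 S q ∧ ρ p ≠ ρ q ∧ (x p = x q → ρ q < ρ p) ∧ (ρ q < ρ p → y q < y p) ∧
      (ρ p < ρ q → y p ≤ y q) := by
    intro p q hpq
    have h1 : w0 S p < w0 S q ↔ x p < x q := by
      rw [w0_lt_iff hpq, blockIndex_lt_iff]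
      simp only [Finset.mem_compl]
    have h2 : w0 S p ≠ w0 S q := fun h => hpq.ne (Equiv.injective _ h)
    refine ⟨blockIndex_mono _ hpq.le, h1, h2, fun h => hpq.ne (Equiv.injective _ h),
      fun h3 => leftLE_iff.mp h p q hpq ?_, fun h3 => ?_, fun h3 => blockIndex_mono _ h3.le⟩
    · exact lt_of_le_of_ne (not_lt.mp fun h4 => (h1.mp h4).ne h3) h2.symm
    · refine blockIndex_lt_iff.mpr ?_
      by_contra! hc
      have h4 := rel_of_consecutive (fun a b => ρ.symm a < ρ.symm b) (fun _ _ _ => lt_trans) h3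
        fun i hi1 hi2 => (lt_or_gt_letters ρ i).resolve_right fun h5 =>
          (hc i (mem_leftDescents.mpr h5) hi1).not_gt hi2
      simp only [Equiv.symm_apply_apply] at h4
      exact h4.asymm hpq
  have hg : Function.Injective g := by
    intro p q hpq
    have h1 : x p = x q := congrArg Prod.fst hpq
    have h2 : y p = y q := congrArg Prod.snd hpq
    rcases lt_trichotomy p q with h3 | h3 | h3
    · have := key p q h3
      omega
    · exact h3
    · have := key q p h3
      omega
  have hle : ∀ p q, g p ≤ g q ↔ w0 S p ≤ w0 S q ∧ ρ p ≤ ρ q := by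
    intro p q
    change x p ≤ x q ∧ y p ≤ y q ↔ _
    rcases lt_trichotomy p q with h3 | rfl | h3
    · have := key p q h3
      omega
    · simp
    · have := key q p h3
      omega
  have hD : IsDiagram n (lowerDiagram S ρ) := isDiagram_image hg (image_blockIndex hn _)
    ((image_comp_perm _ ρ).trans (image_blockIndex hn _))
  refine ⟨hD, (leftInterval_eq_of_boxes hg h hle).trans ?_⟩
  have heq : fillingOfBoxes g hg = fillDown (lowerDiagram S ρ) hD.card_eq := by
    refine equiv_eq_of_le_iff _ _ fun b c => ?_
    obtain ⟨p, rfl⟩ := (fillingOfBoxes g hg).symm.surjective b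
    obtain ⟨q, rfl⟩ := (fillingOfBoxes g hg).symm.surjective c
    refine Iff.trans ?_ (fillDown_le_iff hD.card_eq _ _).symm
    rw [Equiv.apply_symm_apply, Equiv.apply_symm_apply]
    change p ≤ q ↔ x p < x q ∨ x p = x q ∧ y q ≤ y p
    rcases lt_trichotomy p q with h3 | rfl | h3
    · have := key p q h3
      omega
    · simp
    · have := key q p h3
      omega
  exact congrArg (fun F => linearExtensions (posetOf F)) heq

/-- For an upper descent interval the boxes of the positions increase as in `fillRight`: letters in
the same block of positions are increasing, and letters in the same block of values have decreasing
positions. -/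
theorem upper_descent_interval (hn : 0 < n) {S : Finset (Fin (n - 1))} {σ : Equiv.Perm (Fin n)}
    (h : LeftLE σ (w1 S)) :
    ∃ hE : IsDiagram n (upperDiagram σ S), leftInterval σ (w1 S) =
      linearExtensions (posetOf (fillRight (upperDiagram σ S) hE.card_eq)) := by
  let x : Fin n → ℕ := fun k => blockIndex (leftDescents σ)ᶜ (σ k)
  let y : Fin n → ℕ := fun k => S.card + 2 - blockIndex S k
  let g : Fin n → ℕ × ℕ := fun k => (x k, y k)
  have hmem : ∀ k, 1 ≤ blockIndex S k ∧ blockIndex S k ≤ S.card + 1 := fun k =>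
    Finset.mem_Icc.mp (image_blockIndex hn S ▸ Finset.mem_image_of_mem _ (Finset.mem_univ k))
  have key : ∀ p q : Fin n, p < q → y q ≤ y p ∧ (w1 S q < w1 S p ↔ y q < y p) ∧
      w1 S p ≠ w1 S q ∧ σ p ≠ σ q ∧ (y p = y q → σ p < σ q) ∧ (σ p < σ q → x p < x q) ∧
      (σ q < σ p → x q ≤ x p) := by
    intro p q hpq
    have hp := hmem p
    have hq := hmem q
    have h0 : blockIndex S p ≤ blockIndex S q := blockIndex_mono _ hpq.le
    have h1 : w1 S q < w1 S p ↔ y q < y p := by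
      rw [w1_lt_iff hpq, ← blockIndex_lt_iff]
      simp only [y]
      omega
    have h2 : σ p ≠ σ q := fun h => hpq.ne (Equiv.injective _ h)
    refine ⟨by simp only [y]; omega, h1, fun h => hpq.ne (Equiv.injective _ h), h2,
      fun h3 => ?_, fun h3 => ?_, fun h3 => blockIndex_mono _ h3.le⟩
    · refine lt_of_le_of_ne (not_lt.mp fun h4 => ?_) h2
      exact (h1.mp (leftLE_iff.mp h p q hpq h4)).ne h3.symm
    · refine blockIndex_lt_iff.mpr ?_
      by_contra! hc
      have h4 := rel_of_consecutive (fun a b => σ.symm b < σ.symm a)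
        (fun _ _ _ h1 h2 => h2.trans h1) h3 fun i hi1 hi2 => by
          by_contra h5
          exact (hc i (by rwa [Finset.mem_compl, mem_leftDescents]) hi1).not_gt hi2
      simp only [Equiv.symm_apply_apply] at h4
      exact h4.asymm hpq
  have hg : Function.Injective g := by
    intro p q hpq
    have h1 : x p = x q := congrArg Prod.fst hpq
    have h2 : y p = y q := congrArg Prod.snd hpq
    rcases lt_trichotomy p q with h3 | h3 | h3
    · have := key p q h3
      omega
    · exact h3
    · have := key q p h3
      omega
  have hle : ∀ p q, g p ≤ g q ↔ σ p ≤ σ q ∧ w1 S p ≤ w1 S q := by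
    intro p q
    change x p ≤ x q ∧ y p ≤ y q ↔ _
    rcases lt_trichotomy p q with h3 | rfl | h3
    · have := key p q h3
      omega
    · simp
    · have := key q p h3
      omega
  have hrows : Finset.univ.image y = Finset.Icc 1 (S.card + 1) := by
    have h1 : Finset.univ.image y =
        (Finset.univ.image (blockIndex S)).image fun j => S.card + 2 - j := by
      rw [Finset.image_image]
      rfl
    rw [h1, image_blockIndex hn]
    ext j
    simp only [Finset.mem_image, Finset.mem_Icc]
    constructor
    · rintro ⟨i, hi, rfl⟩
      omega
    · intro hj
      exact ⟨S.card + 2 - j, by omega, by omega⟩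
  have hE : IsDiagram n (upperDiagram σ S) := isDiagram_image hg
    ((image_comp_perm _ σ).trans (image_blockIndex hn _)) hrows
  refine ⟨hE, (leftInterval_eq_of_boxes hg h hle).trans ?_⟩
  have heq : fillingOfBoxes g hg = fillRight (upperDiagram σ S) hE.card_eq := by
    refine equiv_eq_of_le_iff _ _ fun b c => ?_
    obtain ⟨p, rfl⟩ := (fillingOfBoxes g hg).symm.surjective b
    obtain ⟨q, rfl⟩ := (fillingOfBoxes g hg).symm.surjective c
    refine Iff.trans ?_ (fillRight_le_iff hE.card_eq _ _).symm
    rw [Equiv.apply_symm_apply, Equiv.apply_symm_apply]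
    change p ≤ q ↔ y q < y p ∨ y p = y q ∧ x p ≤ x q
    rcases lt_trichotomy p q with h3 | rfl | h3
    · have := key p q h3
      omega
    · simp
    · have := key q p h3
      omega
  exact congrArg (fun F => linearExtensions (posetOf F)) heq

end DescentIntervals

end WeakBruhat

theorem mainTheorem4 (n : ℕ) (hn : 0 < n) (S : Finset (Fin (n - 1))) :
    (∀ ρ : Equiv.Perm (Fin n), WeakBruhat.LeftLE (WeakBruhat.w0 S) ρ →
      WeakBruhat.FreeOfStrictlyUpperRight (WeakBruhat.lowerDiagram S ρ) →
      ∃ hD : WeakBruhat.IsDiagram n (WeakBruhat.lowerDiagram S ρ),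
        WeakBruhat.IsMaxOf
          (WeakBruhat.descentClass (WeakBruhat.leftInterval (WeakBruhat.w0 S) ρ))
          (WeakBruhat.linearExtensions (WeakBruhat.posetOf
            (WeakBruhat.fillRight (WeakBruhat.lowerDiagram S ρ) hD.card_eq))) ∧
        WeakBruhat.linearExtensions (WeakBruhat.posetOf
            (WeakBruhat.fillRight (WeakBruhat.lowerDiagram S ρ) hD.card_eq)) =
          WeakBruhat.leftInterval
            (WeakBruhat.readLRTB hD.card_eq
              (WeakBruhat.colTableau (WeakBruhat.lowerDiagram S ρ) hD.card_eq))
            (WeakBruhat.w1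
              (WeakBruhat.compSet n (WeakBruhat.rowLengths (WeakBruhat.lowerDiagram S ρ)))) ∧
        WeakBruhat.descentClass (WeakBruhat.leftInterval (WeakBruhat.w0 S) ρ) =
          WeakBruhat.tableauIntervals hD ∧
        WeakBruhat.IsoToTableaux hD
          (WeakBruhat.descentClass (WeakBruhat.leftInterval (WeakBruhat.w0 S) ρ))) ∧
    (∀ σ : Equiv.Perm (Fin n), WeakBruhat.LeftLE σ (WeakBruhat.w1 S) →
      WeakBruhat.FreeOfStrictlyUpperRight (WeakBruhat.upperDiagram σ S) →
      ∃ hE : WeakBruhat.IsDiagram n (WeakBruhat.upperDiagram σ S),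
        WeakBruhat.IsMinOf
          (WeakBruhat.descentClass (WeakBruhat.leftInterval σ (WeakBruhat.w1 S)))
          (WeakBruhat.linearExtensions (WeakBruhat.posetOf
            (WeakBruhat.fillDown (WeakBruhat.upperDiagram σ S) hE.card_eq))) ∧
        WeakBruhat.linearExtensions (WeakBruhat.posetOf
            (WeakBruhat.fillDown (WeakBruhat.upperDiagram σ S) hE.card_eq)) =
          WeakBruhat.leftInterval
            (WeakBruhat.w0
              (WeakBruhat.compSet n (WeakBruhat.colLengths (WeakBruhat.upperDiagram σ S)))ᶜ)
            (WeakBruhat.readTBLR hE.card_eq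
              (WeakBruhat.rowTableau (WeakBruhat.upperDiagram σ S) hE.card_eq)) ∧
        WeakBruhat.descentClass (WeakBruhat.leftInterval σ (WeakBruhat.w1 S)) =
          WeakBruhat.tableauIntervals hE ∧
        WeakBruhat.IsoToTableaux hE
          (WeakBruhat.descentClass (WeakBruhat.leftInterval σ (WeakBruhat.w1 S)))) := by
  refine ⟨fun ρ hρ hfree => ?_, fun σ hσ hfree => ?_⟩
  · obtain ⟨hD, hI⟩ := WeakBruhat.lower_descent_interval hn hρ
    have hC := WeakBruhat.descentClass_eq_tableauIntervals hD hfree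
      (WeakBruhat.fillDown_southeastIncreasing hD.card_eq)
    rw [hI, hC]
    refine ⟨hD, WeakBruhat.isMaxOf_fillRight hD, ?_, rfl,
      WeakBruhat.isoToTableaux_tableauIntervals hD⟩
    rw [WeakBruhat.linearExtensions_eq_leftInterval hD.card_eq
      (WeakBruhat.fillRight_southeastIncreasing hD.card_eq), WeakBruhat.topPerm_fillRight hD]
    rfl
  · obtain ⟨hE, hI⟩ := WeakBruhat.upper_descent_interval hn hσ
    have hC := WeakBruhat.descentClass_eq_tableauIntervals hE hfree
      (WeakBruhat.fillRight_southeastIncreasing hE.card_eq)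
    rw [hI, hC]
    refine ⟨hE, WeakBruhat.isMinOf_fillDown hE, ?_, rfl,
      WeakBruhat.isoToTableaux_tableauIntervals hE⟩
    rw [WeakBruhat.linearExtensions_eq_leftInterval hE.card_eq
      (WeakBruhat.fillDown_southeastIncreasing hE.card_eq), WeakBruhat.bottomPerm_fillDown hE]
    rfl
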